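/- Conventions. For a Kähler manifold $(M,\omega)$ with complex structure $J$, let $g$ be the associated Riemannian metric, $\omega(u,v)=g(Ju,v)$. Extend $g$ and its Riemann curvature tensor $R$ complex-multilinearly to $TM\otimes\mathbb C$, with the order of arguments chosen so that $R(u,v,u,v)$ is the sectional curvature of the plane spanned by orthonormal real vectors $u,v$. Put $\langle X,Y\rangle=g(X,\bar Y)$ and $|X|^2=\langle X,X\rangle$ on $T^{1,0}M$. Let $Ric(\omega)$ and $R(\omega)$ be the Ricci curvature and the scalar curvature of the Riemannian metric $g$. A holomorphic isometry $\phi:(M,\omega)\to(\hat M,\hat\omega)$ is a holomorphic map with $\phi^*\hat\omega=\omega$ (equivalently, $\phi^*\hat g=g$). **Lemma 4.1.** Let $(\hat M,\hat\omega)$ be an $N$-dimensional Kähler manifold with curvature tensor $\hat R$, and for $\hat q\in\hat M$ set $$K(\hat q)=\sup_{X,Y\in T^{1,0}_{\hat q}\hat M\setminus\{0\}}\frac{\hat R(X,\bar X,\bar Y,Y)}{|X|^2|Y|^2+|\langle X,Y\rangle|^2}.$$ The set of which the supremum is taken is bounded above. Let $(M,\omega)$ be an $n$-dimensional Kähler manifold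 and $\phi:(M,\omega)\to(\hat M,\hat\omega)$ a holomorphic isometry. Then for every $q\in M$ and all nonzero $X,Y\in T^{1,0}_qM$, $$\frac14R(\omega)(q)-\frac{n^2+n-2}{2}K(\phi(q))\;\le\;\frac{R(X,\bar X,\bar Y,Y)}{|X|^2|Y|^2+|\langle X,Y\rangle|^2}\;\le\;K(\phi(q)).$$ Consequently, if $\hat M$ is compact, then for every $R_0\in\mathbb R$ there is a constant $K_1\in\mathbb R$, depending only on $n$, $R_0$ and $(\hat M,\hat\omega)$, such that for every $n$-dimensional Kähler manifold $(M,\omega)$ with $R(\omega)\ge R_0$ that admits a holomorphic isometry into $(\hat M,\hat\omega)$, $$Ric(\omega)\ge -2n(n+1)K_1\,\omega,$$ that is, $Ric(v,v)\ge-2n(n+1)K_1\,g(v,v)$ for all real tangent vectors $v$. -/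

import Mathlib

open scoped Manifold ContDiff

universe u v

/-! ### Complex manifolds and their real tangent spaces

Complex manifolds are modelled on a finite-dimensional complex normed space `E`
(`ℂⁿ` in the theorem), with holomorphic transition maps. -/

section RealStructure

variable {E : Type*} [NormedAddCommGroup E] [NormedSpace ℂ E]
  {M : Type*} [TopologicalSpace M] [ChartedSpace E M]

/-- The real-analytic manifold underlying a complex manifold. -/
instance realManifold_of_complex [h : IsManifold 𝓘(ℂ, E) ω M] : IsManifold 𝓘(ℝ, E) ω M := by
  refine isManifold_of_contDiffOn 𝓘(ℝ, E) ω M fun e e' he he' => ?_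
  have h1 := h.compatible he he'
  rw [contDiffGroupoid, mem_groupoid_of_pregroupoid] at h1
  exact ContDiffOn.restrict_scalars ℝ h1.1

variable (E) in
/-- The real tangent space of a complex manifold at `q`.  In Mathlib it is a copy of `E`, a vector
being represented by its coordinates in the preferred (holomorphic) chart at `q`. -/
abbrev RealTangent (q : M) : Type _ := TangentSpace 𝓘(ℝ, E) q

/-- The complex structure `J` of the tangent space at `q`: multiplication by `i` in holomorphic
coordinates. -/
noncomputable def cplxJ (q : M) (v : RealTangent E q) : RealTangent E q :=
  Complex.I • (show E from v)

end RealStructure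

/-! ### Riemannian geometry in a coordinate domain

`G x` is the metric at the point `x` of a coordinate domain in the real vector space `V`. -/

section LocalGeometry

variable {V : Type*} [NormedAddCommGroup V] [NormedSpace ℝ V]

/-- The Christoffel symbol `Γ_x(u, v) = ∇_u v` of the Levi-Civita connection of `G`, for constant
vector fields `u`, `v`.  It is determined by the Koszul formula
`G_x(Γ_x(u, v), w) = ½ (∂_u G(v, w) + ∂_v G(u, w) - ∂_w G(u, v))`; the last term below is
the linear form `w ↦ ∂_w G(u, v)`. -/
noncomputable def christoffel (G : V → V →L[ℝ] V →L[ℝ] ℝ) (x u v : V) : V :=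
  (G x).inverse ((1 / 2 : ℝ) •
    (fderiv ℝ G x u v + fderiv ℝ G x v u - ((fderiv ℝ G x).flip u).flip v))

/-- The curvature endomorphism `R(u, v) w = ∇_u ∇_v w - ∇_v ∇_u w` at `x`, for constant vector
fields `u`, `v`, `w`. -/
noncomputable def curvatureEndo (G : V → V →L[ℝ] V →L[ℝ] ℝ) (x u v w : V) : V :=
  (fderiv ℝ (fun y => christoffel G y v w) x u + christoffel G x u (christoffel G x v w))
    - (fderiv ℝ (fun y => christoffel G y u w) x v + christoffel G x v (christoffel G x u w))

/-- The trace `∑ g^{ij} β(b_i, b_j)` of a bilinear form `β` with respect to the inner product `g`,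
where `(g^{ij})` is the inverse of the Gram matrix of a basis `b`. -/
noncomputable def metricTrace [FiniteDimensional ℝ V] (g β : V → V → ℝ) : ℝ :=
  let b := Module.finBasis ℝ V
  let gram : Matrix (Fin (Module.finrank ℝ V)) (Fin (Module.finrank ℝ V)) ℝ :=
    Matrix.of fun i j => g (b i) (b j)
  ∑ i, ∑ j, gram⁻¹ i j * β (b i) (b j)

end LocalGeometry

/-! ### Complexification -/

section Complexification

variable {V : Type*}

/-- Complex-linear extension of a real-linear map `f : V → ℂ` to `V ⊗ ℂ = V × V`, the pair `(a, b)`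
standing for `a + i b`. -/
noncomputable def cExt (f : V → ℂ) (Z : V × V) : ℂ := f Z.1 + Complex.I * f Z.2

/-- Complex-bilinear extension of a real-bilinear form. -/
noncomputable def cExt2 (B : V → V → ℝ) (Z W : V × V) : ℂ :=
  cExt (fun a => cExt (fun b => (B a b : ℂ)) W) Z

/-- Complex-multilinear extension of a real tensor of type `(0, 4)`. -/
noncomputable def cExt4 (T : V → V → V → V → ℝ) (Z₁ Z₂ Z₃ Z₄ : V × V) : ℂ :=
  cExt (fun a => cExt (fun b => cExt (fun c => cExt (fun d => (T a b c d : ℂ)) Z₄) Z₃) Z₂) Z₁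

/-- Complex conjugation of `V ⊗ ℂ`. -/
def cConj [Neg V] (Z : V × V) : V × V := (Z.1, -Z.2)

end Complexification

/-! ### Kähler manifolds -/

section Kahler

variable {E : Type*} [NormedAddCommGroup E] [NormedSpace ℂ E]
  {M : Type*} [TopologicalSpace M] [ChartedSpace E M] [IsManifold 𝓘(ℂ, E) ω M]

/-- The coordinate expression of a Riemannian metric on the domain of the preferred chart at `q`:
the pull-back of the metric by the inverse of the chart. -/
noncomputable def chartMetric
    (g : Bundle.ContMDiffRiemannianMetric 𝓘(ℝ, E) ∞ E
      (fun p : M => TangentSpace 𝓘(ℝ, E) p)) (q : M) (x : E) : E →L[ℝ] E →L[ℝ] ℝ :=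
  let D : E →L[ℝ] E := mfderiv 𝓘(ℝ, E) 𝓘(ℝ, E) (extChartAt 𝓘(ℝ, E) q).symm x
  let B : E →L[ℝ] E →L[ℝ] ℝ := g.inner ((extChartAt 𝓘(ℝ, E) q).symm x)
  B.bilinearComp D D

variable (E M) in
/-- A Kähler metric on a complex manifold: a smooth Riemannian metric `g` that is `J`-invariant and
whose fundamental form `ω(u, v) = g(J u, v)` is closed.  In a holomorphic chart `J` is the
multiplication by `i`, and
`dω(u, v, w) = ∂_u ω(v, w) + ∂_v ω(w, u) + ∂_w ω(u, v)` for constant vectors `u`, `v`, `w`. -/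
structure KahlerMetric extends Bundle.ContMDiffRiemannianMetric 𝓘(ℝ, E) ∞ E
    (fun p : M => TangentSpace 𝓘(ℝ, E) p) where
  inner_cplxJ : ∀ (q : M) (u v : RealTangent E q), inner q (cplxJ q u) (cplxJ q v) = inner q u v
  closed : ∀ (q : M), ∀ x ∈ (extChartAt 𝓘(ℝ, E) q).target, ∀ u v w : E,
    fderiv ℝ (chartMetric toContMDiffRiemannianMetric q) x u (Complex.I • v) w
      + fderiv ℝ (chartMetric toContMDiffRiemannianMetric q) x v (Complex.I • w) u
      + fderiv ℝ (chartMetric toContMDiffRiemannianMetric q) x w (Complex.I • u) v = 0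

namespace KahlerMetric

variable (g : KahlerMetric E M)

/-- The Riemann curvature tensor `R(u, v, w, z) = g(R(u, v) z, w)` at `q`, computed in the preferred
chart at `q`, whose coordinates are those of `RealTangent E q`.  With this order of the arguments
`R(u, v, u, v)` is the sectional curvature of the plane spanned by orthonormal `u`, `v`. -/
noncomputable def riemann (q : M) (u v w z : RealTangent E q) : ℝ :=
  g.inner q
    (curvatureEndo (V := E) (chartMetric g.toContMDiffRiemannianMetric q)
      (extChartAt 𝓘(ℝ, E) q q) u v z) w

/-- The Ricci curvature of the Riemannian metric, `Ric(v, w) = ∑ g^{ij} R(b_i, v, b_j, w)`. -/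
noncomputable def ricci [FiniteDimensional ℂ E] (q : M) (v w : RealTangent E q) : ℝ :=
  metricTrace (V := E) (fun a b => g.inner q a b) (fun a b => g.riemann q a v b w)

/-- The scalar curvature of the Riemannian metric, the trace of the Ricci curvature. -/
noncomputable def scalarCurvature [FiniteDimensional ℂ E] (q : M) : ℝ :=
  metricTrace (V := E) (fun a b => g.inner q a b) (fun a b => g.ricci q a b)

variable (E) in
/-- The holomorphic tangent space `T^{1,0}_q M ⊆ T_q M ⊗ ℂ`, the `i`-eigenspace of `J`.  Elements
`a + i b` of `T_q M ⊗ ℂ` are pairs `(a, b)`, so `J Z = i Z` says `J a = -b` and `J b = a`. -/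
def holTangent (q : M) : Set (RealTangent E q × RealTangent E q) :=
  {Z | cplxJ q Z.1 = -Z.2 ∧ cplxJ q Z.2 = Z.1}

/-- The Hermitian product `⟨X, Y⟩ = g(X, Ȳ)` on `T_q M ⊗ ℂ`. -/
noncomputable def hermInner (q : M) (X Y : RealTangent E q × RealTangent E q) : ℂ :=
  cExt2 (fun a b => g.inner q a b) X (cConj Y)

/-- The square norm `|X|² = ⟨X, X⟩`. -/
noncomputable def hermNormSq (q : M) (X : RealTangent E q × RealTangent E q) : ℝ :=
  (g.hermInner q X X).re

/-- The quotient `R(X, X̄, Ȳ, Y) / (|X|² |Y|² + |⟨X, Y⟩|²)`; its numerator is a real number. -/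
noncomputable def bisectional (q : M) (X Y : RealTangent E q × RealTangent E q) : ℝ :=
  (cExt4 (g.riemann q) X (cConj X) (cConj Y) Y).re
    / (g.hermNormSq q X * g.hermNormSq q Y + ‖g.hermInner q X Y‖ ^ 2)

/-- The values of the quotient `bisectional` on pairs of nonzero vectors of `T^{1,0}_q M`. -/
def bisectionalValues (q : M) : Set ℝ :=
  {r | ∃ X ∈ holTangent E q, ∃ Y ∈ holTangent E q, X ≠ 0 ∧ Y ≠ 0 ∧ r = g.bisectional q X Y}

/-- `K(q) = sup R(X, X̄, Ȳ, Y) / (|X|² |Y|² + |⟨X, Y⟩|²)`, over nonzero `X`, `Y` in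
`T^{1,0}_q M`. -/
noncomputable def bisectionalSup (q : M) : ℝ := sSup (g.bisectionalValues q)

end KahlerMetric

variable {E' : Type*} [NormedAddCommGroup E'] [NormedSpace ℂ E']
  {M' : Type*} [TopologicalSpace M'] [ChartedSpace E' M'] [IsManifold 𝓘(ℂ, E') ω M']

/-- `φ` is a holomorphic isometry: holomorphic (complex analytic) and the pull-back of the metric
`g'` of the target is the metric `g` of the source. -/
structure IsHolomorphicIsometry (g : KahlerMetric E M) (g' : KahlerMetric E' M') (φ : M → M') :
    Prop where
  holomorphic : ContMDiff 𝓘(ℂ, E) 𝓘(ℂ, E') ω φ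
  isometric : ∀ (q : M) (u v : RealTangent E q),
    g'.inner (φ q) (mfderiv 𝓘(ℝ, E) 𝓘(ℝ, E') φ q u) (mfderiv 𝓘(ℝ, E) 𝓘(ℝ, E') φ q v)
      = g.inner q u v

end Kahler

/-!
The bisectional curvature of a pair `X = a - iJa`, `Y = c - iJc` is the quotient of
`R(a, Ja, c, Jc)` by `|a|² |c|² + g(a, c)² + g(a, Jc)²`, so the statement concerns real vectors
`a`, `c`.

*Upper bound.* Let `s` be a holomorphic vector field along a holomorphic disc `f` in a Kähler
manifold. Then `Δ|s|² = 4 |∇s|² - 2 R(f', Jf', s, Js)` (`IsKahlerOn.laplacian_inner`). A holomorphic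
isometry preserves the left-hand side, while the covariant derivative in the source is the
orthogonal projection of the one in the target, hence not longer. Comparison of the two formulas for
the disc `z ↦ x + za` and the constant field `c` gives the Gauss inequality
`IsKahlerOn.bisectional_le_of_isometry`. The curvature at a point is computed in the preferred chart
of that point; the Gauss inequality for the identity map also serves to change the chart, and thus
to bound the bisectional curvature locally, and uniformly on a compact manifold.

*Lower bound.* The quantity `q(a, c) = R(a, Ja, c, Jc)` is a Hermitian form on the symmetric square
of the tangent space, evaluated at the product of `a` and `c`, and the scalar curvature is four times
its trace. The values of the form `K (|a|² |c|² + |⟨a, c⟩|²) - q(a, c)` on products are nonnegative.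
The product of two vectors can be completed to an orthogonal basis consisting of products: in the
span of the two vectors this is the identity `IsKahlerCurvature.bisectional_add_bisectional`. So each
value on a product of unit length is at most the trace, which is the claimed inequality
(`IsKahlerCurvature.le_bisectional`).

*Ricci curvature.* It is the sum of the bisectional curvatures with the members of a unitary frame
(`IsKahlerCurvature.ricci_self_eq_sum`), so the lower bound applies to each summand.
-/

/-! ### Kähler metrics in a coordinate domain -/

section ChartCalculus

-- Instances on `V →L V →L V →L ℝ` need this depth.
set_option maxSynthPendingDepth 3

variable {V : Type*} [NormedAddCommGroup V] [NormedSpace ℂ V]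

/-- `G` is the coordinate expression of a Kähler metric on the open set `U`. -/
structure IsKahlerOn (G : V → V →L[ℝ] V →L[ℝ] ℝ) (U : Set V) : Prop where
  isOpen : IsOpen U
  contDiffOn : ContDiffOn ℝ ∞ G U
  symm : ∀ x ∈ U, ∀ u v, G x u v = G x v u
  pos : ∀ x ∈ U, ∀ v, v ≠ 0 → 0 < G x v v
  inner_I : ∀ x ∈ U, ∀ u v, G x (Complex.I • u) (Complex.I • v) = G x u v
  closed : ∀ x ∈ U, ∀ u v w, fderiv ℝ G x u (Complex.I • v) w
    + fderiv ℝ G x v (Complex.I • w) u + fderiv ℝ G x w (Complex.I • u) v = 0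

/-- The bilinear map `(u, v) ↦ D u v + D v u - D · u v`, whose values are the linear forms on the
right-hand side of the Koszul formula (up to the factor `½`). -/
noncomputable def koszulForm (D : V →L[ℝ] V →L[ℝ] V →L[ℝ] ℝ) : V →L[ℝ] V →L[ℝ] V →L[ℝ] ℝ :=
  D + D.flip -
    ((ContinuousLinearMap.flipₗᵢ ℝ V V ℝ).toContinuousLinearEquiv :
      (V →L[ℝ] V →L[ℝ] ℝ) →L[ℝ] V →L[ℝ] V →L[ℝ] ℝ) ∘L D.flip

/-- The Christoffel symbol as a continuous bilinear map. -/
noncomputable def christoffelCLM (G : V → V →L[ℝ] V →L[ℝ] ℝ) (x : V) : V →L[ℝ] V →L[ℝ] V :=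
  (ContinuousLinearMap.compL ℝ V (V →L[ℝ] ℝ) V (G x).inverse) ∘L
    ((1 / 2 : ℝ) • koszulForm (fderiv ℝ G x))

theorem christoffelCLM_apply (G : V → V →L[ℝ] V →L[ℝ] ℝ) (x u v : V) :
    christoffelCLM G x u v = christoffel G x u v := rfl

theorem hasFDerivAt_of_mem {W : Type*} [NormedAddCommGroup W] [NormedSpace ℝ W] {f : V → W}
    {U : Set V} (hU : IsOpen U) (hf : ContDiffOn ℝ ∞ f U) {x : V} (hx : x ∈ U) :
    HasFDerivAt f (fderiv ℝ f x) x :=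
  ((hf.contDiffAt (hU.mem_nhds hx)).differentiableAt (by simp)).hasFDerivAt

namespace IsKahlerOn

variable {G : V → V →L[ℝ] V →L[ℝ] ℝ} {U : Set V} (h : IsKahlerOn G U) {x : V} (hx : x ∈ U)
include h

theorem contDiffOn_fderiv : ContDiffOn ℝ ∞ (fderiv ℝ G) U :=
  h.contDiffOn.fderiv_of_isOpen h.isOpen (by simp)

include hx

theorem hasFDerivAt : HasFDerivAt G (fderiv ℝ G x) x :=
  hasFDerivAt_of_mem h.isOpen h.contDiffOn hx

theorem hasFDerivAt_apply (v w : V) :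
    HasFDerivAt (fun y => G y v w)
      (((ContinuousLinearMap.apply ℝ ℝ w) ∘L (ContinuousLinearMap.apply ℝ (V →L[ℝ] ℝ) v)) ∘L
        fderiv ℝ G x) x :=
  ((ContinuousLinearMap.apply ℝ ℝ w) ∘L
    (ContinuousLinearMap.apply ℝ (V →L[ℝ] ℝ) v)).hasFDerivAt.comp x (h.hasFDerivAt hx)

theorem fderiv_symm (u v w : V) : fderiv ℝ G x u v w = fderiv ℝ G x u w v := by
  have h1 := h.hasFDerivAt_apply hx v w
  have h2 := h.hasFDerivAt_apply hx w v
  have : (fun y => G y v w) =ᶠ[nhds x] fun y => G y w v := by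
    filter_upwards [h.isOpen.mem_nhds hx] with y hy using h.symm y hy v w
  simpa using congrArg (fun L => L u) (h1.unique (h2.congr_of_eventuallyEq this))

theorem fderiv_I (u v w : V) :
    fderiv ℝ G x u (Complex.I • v) (Complex.I • w) = fderiv ℝ G x u v w := by
  have h1 := h.hasFDerivAt_apply hx (Complex.I • v) (Complex.I • w)
  have h2 := h.hasFDerivAt_apply hx v w
  have : (fun y => G y (Complex.I • v) (Complex.I • w)) =ᶠ[nhds x] fun y => G y v w := by
    filter_upwards [h.isOpen.mem_nhds hx] with y hy using h.inner_I y hy v w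
  simpa using congrArg (fun L => L u) (h1.unique (h2.congr_of_eventuallyEq this))

theorem eq_of_inner_eq {a b : V} (hab : ∀ w, G x a w = G x b w) : a = b := by
  by_contra hne
  have := h.pos x hx (a - b) (sub_ne_zero.2 hne)
  have h2 := hab (a - b)
  rw [h.symm x hx a, h.symm x hx b] at h2
  rw [map_sub] at this
  linarith

theorem inner_nonneg (v : V) : 0 ≤ G x v v := by
  rcases eq_or_ne v 0 with rfl | hv
  · simp
  · exact (h.pos x hx v hv).le

theorem inner_I_left (u v : V) : G x (Complex.I • u) v = - G x u (Complex.I • v) := by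
  have := h.inner_I x hx u (Complex.I • v)
  rw [smul_smul, Complex.I_mul_I, neg_one_smul, map_neg] at this
  linarith

variable [FiniteDimensional ℂ V]

theorem isInvertible : (G x).IsInvertible := by
  have hinj : Function.Injective (G x : V →ₗ[ℝ] V →L[ℝ] ℝ) := by
    intro a b hab
    exact h.eq_of_inner_eq hx fun w => congrArg (fun L : V →L[ℝ] ℝ => L w) hab
  have hfin : Module.finrank ℝ V = Module.finrank ℝ (V →L[ℝ] ℝ) := by
    rw [← (LinearMap.toContinuousLinearMap (𝕜 := ℝ) (E := V) (F' := ℝ)).finrank_eq]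
    exact (Subspace.dual_finrank_eq (K := ℝ) (V := V)).symm
  refine ⟨(LinearMap.linearEquivOfInjective _ hinj hfin).toContinuousLinearEquiv, ?_⟩
  ext a w
  rfl

/-- The Koszul formula. -/
theorem inner_christoffel (u v w : V) :
    G x (christoffelCLM G x u v) w =
      1 / 2 * (fderiv ℝ G x u v w + fderiv ℝ G x v u w - fderiv ℝ G x w u v) := by
  rw [christoffelCLM_apply, christoffel]
  obtain ⟨e, he⟩ := h.isInvertible hx
  rw [← he, ContinuousLinearMap.inverse_equiv]
  simp

theorem christoffel_symm (u v : V) : christoffelCLM G x u v = christoffelCLM G x v u := by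
  refine h.eq_of_inner_eq hx fun w => ?_
  rw [h.inner_christoffel hx, h.inner_christoffel hx, h.fderiv_symm hx w u v]
  ring

/-- The Levi-Civita connection is compatible with the metric. -/
theorem fderiv_eq_christoffel (u v w : V) :
    fderiv ℝ G x u v w = G x (christoffelCLM G x u v) w + G x v (christoffelCLM G x u w) := by
  rw [h.symm x hx v, h.inner_christoffel hx, h.inner_christoffel hx, h.fderiv_symm hx w u v,
    h.fderiv_symm hx v u w, h.fderiv_symm hx u w v]
  ring

/-- The Levi-Civita connection of a Kähler metric commutes with the complex structure. -/
theorem christoffel_I (u v : V) :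
    christoffelCLM G x u (Complex.I • v) = Complex.I • christoffelCLM G x u v := by
  refine h.eq_of_inner_eq hx fun w => ?_
  have hI : ∀ a b c, fderiv ℝ G x a (Complex.I • b) c = - fderiv ℝ G x a b (Complex.I • c) := by
    intro a b c
    have := h.fderiv_I hx a b (Complex.I • c)
    rw [smul_smul, Complex.I_mul_I, neg_one_smul, map_neg] at this
    linarith
  rw [h.inner_I_left hx, h.inner_christoffel hx, h.inner_christoffel hx]
  -- Closedness is needed for `(u, v, w)` and for `(u, Iv, Iw)`.
  have c1 := h.closed x hx u v w
  have c2 := h.closed x hx u (Complex.I • v) (Complex.I • w)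
  simp only [smul_smul, Complex.I_mul_I, neg_one_smul, map_neg, neg_apply,
    h.fderiv_I hx] at c2
  have e1 := hI u v w
  have e2 := hI v w u
  have e3 := hI w u v
  have e4 := h.fderiv_symm hx v u (Complex.I • w)
  have e5 := h.fderiv_symm hx v w (Complex.I • u)
  have e6 := h.fderiv_symm hx (Complex.I • v) u w
  have e7 := h.fderiv_symm hx v (Complex.I • w) u
  linarith

theorem christoffel_I_left (u v : V) :
    christoffelCLM G x (Complex.I • u) v = Complex.I • christoffelCLM G x u v := by
  rw [h.christoffel_symm hx, h.christoffel_I hx, h.christoffel_symm hx]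

omit hx

theorem contDiffOn_christoffel : ContDiffOn ℝ ∞ (christoffelCLM G) U := by
  have h1 : ContDiffOn ℝ ∞ (fun x => (G x).inverse) U := by
    intro x hx
    obtain ⟨e, he⟩ := h.isInvertible hx
    have h2 := contDiffAt_map_inverse (n := ∞) e
    rw [he] at h2
    exact (h2.comp x (h.contDiffOn.contDiffAt (h.isOpen.mem_nhds hx))).contDiffWithinAt
  have h3 := h.contDiffOn_fderiv
  have h4 : ContDiffOn ℝ ∞ (fun x => (fderiv ℝ G x).flip) U :=
    (ContinuousLinearMap.flipₗᵢ ℝ V V (V →L[ℝ] ℝ)).contDiff.comp_contDiffOn h3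
  unfold christoffelCLM koszulForm
  refine ContDiffOn.clm_comp ?_ (((h3.add h4).sub
    (ContDiffOn.clm_comp contDiffOn_const h4)).const_smul (1 / 2 : ℝ))
  exact (ContinuousLinearMap.compL ℝ V (V →L[ℝ] ℝ) V).contDiff.comp_contDiffOn h1

include hx

theorem hasFDerivAt_christoffel :
    HasFDerivAt (christoffelCLM G) (fderiv ℝ (christoffelCLM G) x) x :=
  hasFDerivAt_of_mem h.isOpen h.contDiffOn_christoffel hx

theorem hasFDerivAt_christoffel_apply (v w : V) :
    HasFDerivAt (fun y => christoffelCLM G y v w)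
      (((ContinuousLinearMap.apply ℝ V w) ∘L (ContinuousLinearMap.apply ℝ (V →L[ℝ] V) v)) ∘L
        fderiv ℝ (christoffelCLM G) x) x :=
  ((ContinuousLinearMap.apply ℝ V w) ∘L
    (ContinuousLinearMap.apply ℝ (V →L[ℝ] V) v)).hasFDerivAt.comp x (h.hasFDerivAt_christoffel hx)

theorem curvatureEndo_eq (u v w : V) :
    curvatureEndo G x u v w =
      (fderiv ℝ (christoffelCLM G) x u v w + christoffelCLM G x u (christoffelCLM G x v w))
      - (fderiv ℝ (christoffelCLM G) x v u w + christoffelCLM G x v (christoffelCLM G x u w)) := by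
  unfold curvatureEndo
  simp only [← christoffelCLM_apply]
  rw [(h.hasFDerivAt_christoffel_apply hx v w).fderiv,
    (h.hasFDerivAt_christoffel_apply hx u w).fderiv]
  rfl

theorem fderiv_christoffel_symm (u v w : V) :
    fderiv ℝ (christoffelCLM G) x u v w = fderiv ℝ (christoffelCLM G) x u w v := by
  have h1 := h.hasFDerivAt_christoffel_apply hx v w
  have h2 := h.hasFDerivAt_christoffel_apply hx w v
  have : (fun y => christoffelCLM G y v w) =ᶠ[nhds x] fun y => christoffelCLM G y w v := by
    filter_upwards [h.isOpen.mem_nhds hx] with y hy using h.christoffel_symm hy v w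
  simpa using congrArg (fun L => L u) (h1.unique (h2.congr_of_eventuallyEq this))

theorem fderiv_christoffel_I (u v w : V) :
    fderiv ℝ (christoffelCLM G) x u v (Complex.I • w) =
      Complex.I • fderiv ℝ (christoffelCLM G) x u v w := by
  have h1 := h.hasFDerivAt_christoffel_apply hx v (Complex.I • w)
  have h2 := (h.hasFDerivAt_christoffel_apply hx v w).const_smul Complex.I
  have : (fun y => christoffelCLM G y v (Complex.I • w)) =ᶠ[nhds x]
      fun y => Complex.I • christoffelCLM G y v w := by
    filter_upwards [h.isOpen.mem_nhds hx] with y hy using h.christoffel_I hy v w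
  simpa using congrArg (fun L => L u) (h1.unique (h2.congr_of_eventuallyEq this))

theorem fderiv_christoffel_I_left (u v w : V) :
    fderiv ℝ (christoffelCLM G) x u (Complex.I • v) w =
      Complex.I • fderiv ℝ (christoffelCLM G) x u v w := by
  rw [h.fderiv_christoffel_symm hx, h.fderiv_christoffel_I hx, h.fderiv_christoffel_symm hx]

/-- The curvature is skew-adjoint: this is the symmetry of the second derivatives of the metric. -/
theorem inner_curvatureEndo_skew (u v w z : V) :
    G x (curvatureEndo G x u v w) z = - G x w (curvatureEndo G x u v z) := by
  have key : ∀ a b : V, fderiv ℝ (fderiv ℝ G) x a b w z =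
      fderiv ℝ G x a (christoffelCLM G x b w) z + G x (fderiv ℝ (christoffelCLM G) x a b w) z
      + (fderiv ℝ G x a w (christoffelCLM G x b z)
        + G x w (fderiv ℝ (christoffelCLM G) x a b z)) := by
    intro a b
    have h1 : HasFDerivAt (fderiv ℝ G) (fderiv ℝ (fderiv ℝ G) x) x :=
      hasFDerivAt_of_mem h.isOpen h.contDiffOn_fderiv hx
    have h1' := ((h1.clm_apply (hasFDerivAt_const b x)).clm_apply (hasFDerivAt_const w x)).clm_apply
      (hasFDerivAt_const z x)
    have h2 := ((h.hasFDerivAt hx).clm_apply (h.hasFDerivAt_christoffel_apply hx b w)).clm_apply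
      (hasFDerivAt_const z x)
    have h3 := ((h.hasFDerivAt hx).clm_apply (hasFDerivAt_const w x)).clm_apply
      (h.hasFDerivAt_christoffel_apply hx b z)
    have h4 := h2.add h3
    have : (fun y => fderiv ℝ G y b w z) =ᶠ[nhds x]
        fun y => G y (christoffelCLM G y b w) z + G y w (christoffelCLM G y b z) := by
      filter_upwards [h.isOpen.mem_nhds hx] with y hy using h.fderiv_eq_christoffel hy b w z
    have h5 := congrArg (fun L => L a) (h1'.unique (h4.congr_of_eventuallyEq this))
    simp at h5
    linarith
  have hsymm : fderiv ℝ (fderiv ℝ G) x u v = fderiv ℝ (fderiv ℝ G) x v u :=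
    (h.contDiffOn.contDiffAt (h.isOpen.mem_nhds hx)).isSymmSndFDerivAt
      (by rw [minSmoothness_of_isRCLikeNormedField]; exact WithTop.coe_le_coe.2 (le_top : (2 : ℕ∞) ≤ ⊤)) u v
  have k1 := key u v
  have k2 := key v u
  rw [hsymm, k2] at k1
  simp only [h.fderiv_eq_christoffel hx] at k1
  simp only [h.curvatureEndo_eq hx, map_add, map_sub, add_apply,
    sub_apply]
  linarith

end IsKahlerOn

/-- A real `(0, 4)`-tensor on a complex vector space with the symmetries of the curvature tensor of
a Kähler metric.  Linearity in the last three arguments follows from the symmetries. -/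
structure IsKahlerCurvature {V : Type*} [AddCommGroup V] [Module ℂ V]
    (T : V → V → V → V → ℝ) : Prop where
  add_left : ∀ u u' v w z, T (u + u') v w z = T u v w z + T u' v w z
  smul_left : ∀ (r : ℝ) u v w z, T ((r : ℂ) • u) v w z = r * T u v w z
  antisymm_left : ∀ u v w z, T v u w z = - T u v w z
  antisymm_right : ∀ u v w z, T u v z w = - T u v w z
  bianchi : ∀ u v w z, T u v w z + T v w u z + T w u v z = 0
  I_right : ∀ u v w z, T u v (Complex.I • w) (Complex.I • z) = T u v w z

/-- The curvature tensor of a Kähler metric in holomorphic coordinates. -/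
theorem IsKahlerOn.isKahlerCurvature [FiniteDimensional ℂ V] {G : V → V →L[ℝ] V →L[ℝ] ℝ}
    {U : Set V} (h : IsKahlerOn G U) {x : V} (hx : x ∈ U) :
    IsKahlerCurvature fun u v w z => G x (curvatureEndo G x u v z) w where
  add_left u u' v w z := by
    simp only [h.curvatureEndo_eq hx, map_add, map_sub, add_apply,
      sub_apply]
    ring
  smul_left r u v w z := by
    simp only [Complex.coe_smul, h.curvatureEndo_eq hx, map_add, map_sub, map_smul,
      add_apply, sub_apply, smul_apply,
      smul_eq_mul]
    ring
  antisymm_left u v w z := by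
    simp only [h.curvatureEndo_eq hx, map_add, map_sub, add_apply,
      sub_apply]
    ring
  antisymm_right u v w z := by
    rw [h.inner_curvatureEndo_skew hx, h.symm x hx]
  bianchi u v w z := by
    have key : ∀ a b c : V,
        G x (curvatureEndo G x a b z) c = - G x (curvatureEndo G x a b c) z := by
      intro a b c
      rw [h.inner_curvatureEndo_skew hx, h.symm x hx]
    have : curvatureEndo G x u v w + curvatureEndo G x v w u + curvatureEndo G x w u v = 0 := by
      simp only [h.curvatureEndo_eq hx]
      rw [h.christoffel_symm hx v w, h.christoffel_symm hx u w, h.christoffel_symm hx v u,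
        h.fderiv_christoffel_symm hx u v w, h.fderiv_christoffel_symm hx v u w,
        h.fderiv_christoffel_symm hx w v u]
      abel
    have h2 := congrArg (fun a => G x a z) this
    simp only [map_add, add_apply, map_zero,
      zero_apply] at h2
    simp only [key]
    linarith
  I_right u v w z := by
    have : curvatureEndo G x u v (Complex.I • z) = Complex.I • curvatureEndo G x u v z := by
      simp only [h.curvatureEndo_eq hx, h.christoffel_I hx, h.fderiv_christoffel_I hx, smul_add,
        smul_sub]
    rw [this, h.inner_I x hx]

end ChartCalculus

/-! ### Holomorphic discs and the Gauss inequality -/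

section Gauss

set_option maxSynthPendingDepth 3

/-- The second derivative of `H` at `0` along the real line spanned by `θ`. -/
noncomputable def secondDerivAlong (H : ℂ → ℝ) (θ : ℂ) : ℝ :=
  deriv (deriv fun t : ℝ => H (t * θ)) 0

theorem secondDerivAlong_congr {H H' : ℂ → ℝ} (hH : H =ᶠ[nhds 0] H') (θ : ℂ) :
    secondDerivAlong H θ = secondDerivAlong H' θ := by
  unfold secondDerivAlong
  have h1 : Filter.Tendsto (fun t : ℝ => (t : ℂ) * θ) (nhds 0) (nhds 0) := by
    have : Continuous fun t : ℝ => (t : ℂ) * θ := by fun_prop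
    simpa using this.tendsto 0
  have h2 : (fun t : ℝ => H (t * θ)) =ᶠ[nhds 0] fun t : ℝ => H' (t * θ) := h1.eventually hH
  exact h2.deriv.deriv_eq

variable {V : Type*} [NormedAddCommGroup V] [NormedSpace ℂ V]

theorem hasDerivAt_comp_line {f : ℂ → V} {θ : ℂ} {t : ℝ} (hf : AnalyticAt ℂ f (t * θ)) :
    HasDerivAt (fun τ : ℝ => f (τ * θ)) (θ • deriv f (t * θ)) t := by
  have h1 : HasDerivAt (fun τ : ℝ => (τ : ℂ) * θ) θ t := by
    simpa using (Complex.ofRealCLM.hasDerivAt (x := t)).mul_const θ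
  exact HasDerivAt.scomp t hf.differentiableAt.hasDerivAt h1

/-- The covariant derivative of the vector field `s` along the holomorphic disc `f`. -/
noncomputable def covDeriv (G : V → V →L[ℝ] V →L[ℝ] ℝ) (f s : ℂ → V) (z : ℂ) : V :=
  deriv s z + christoffelCLM G (f z) (deriv f z) (s z)

namespace IsKahlerOn

variable [FiniteDimensional ℂ V] {G : V → V →L[ℝ] V →L[ℝ] ℝ} {U : Set V} (h : IsKahlerOn G U)
include h

/-- The product rule for the inner product of two vector fields along a curve. -/
theorem hasDerivAt_inner_along {γ σ τ : ℝ → V} {γ' σ' τ' : V} {t : ℝ} (hU : γ t ∈ U)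
    (hγ : HasDerivAt γ γ' t) (hσ : HasDerivAt σ σ' t) (hτ : HasDerivAt τ τ' t) :
    HasDerivAt (fun r => G (γ r) (σ r) (τ r))
      (G (γ t) (σ' + christoffelCLM G (γ t) γ' (σ t)) (τ t)
        + G (γ t) (σ t) (τ' + christoffelCLM G (γ t) γ' (τ t))) t := by
  have h1 := (((h.hasFDerivAt hU).comp_hasDerivAt t hγ).clm_apply hσ).clm_apply hτ
  refine h1.congr_deriv ?_
  simp only [add_apply, map_add, Function.comp_apply, h.fderiv_eq_christoffel hU]
  ring

/-- The coordinate derivative of `∇s` along a line. -/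
theorem hasDerivAt_covDeriv_along {f s : ℂ → V} (hf : AnalyticAt ℂ f 0) (hs : AnalyticAt ℂ s 0)
    (hU : f 0 ∈ U) (θ : ℂ) :
    HasDerivAt (fun t : ℝ => covDeriv G f s (t * θ))
      (θ • deriv (deriv s) 0 +
        (fderiv ℝ (christoffelCLM G) (f 0) (θ • deriv f 0) (deriv f 0) (s 0)
        + christoffelCLM G (f 0) (θ • deriv (deriv f) 0) (s 0)
        + christoffelCLM G (f 0) (deriv f 0) (θ • deriv s 0))) 0 := by
  have e : ((0 : ℝ) : ℂ) * θ = 0 := by simp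
  have d0 := hasDerivAt_comp_line (θ := θ) (t := 0) (f := f) (by rwa [e])
  have d1 := hasDerivAt_comp_line (θ := θ) (t := 0) (f := deriv f) (by rw [e]; exact hf.deriv)
  have d2 := hasDerivAt_comp_line (θ := θ) (t := 0) (f := s) (by rwa [e])
  have d3 := hasDerivAt_comp_line (θ := θ) (t := 0) (f := deriv s) (by rw [e]; exact hs.deriv)
  rw [e] at d0 d1 d2 d3
  have d4 := (((h.hasFDerivAt_christoffel hU).comp_hasDerivAt_of_eq 0 d0 (by simp)).clm_apply
    d1).clm_apply d2
  refine (d3.add d4).congr_deriv ?_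
  simp

/-- The second derivative along a line of the square norm of a holomorphic vector field `s` along a
holomorphic disc `f`. -/
theorem secondDerivAlong_inner {f s : ℂ → V} (hf : AnalyticAt ℂ f 0) (hs : AnalyticAt ℂ s 0)
    (hU : f 0 ∈ U) (θ : ℂ)
    (hI : ∀ (x : V), x ∈ U → ∀ u v, christoffelCLM G x (θ • u) v = θ • christoffelCLM G x u v) :
    secondDerivAlong (fun z => G (f z) (s z) (s z)) θ =
      2 * (G (f 0) (θ • (θ • deriv (deriv s) 0 +
        (fderiv ℝ (christoffelCLM G) (f 0) (θ • deriv f 0) (deriv f 0) (s 0)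
        + christoffelCLM G (f 0) (θ • deriv (deriv f) 0) (s 0)
        + christoffelCLM G (f 0) (deriv f 0) (θ • deriv s 0)))
        + θ • christoffelCLM G (f 0) (deriv f 0) (θ • covDeriv G f s 0)) (s 0)
        + G (f 0) (θ • covDeriv G f s 0) (θ • covDeriv G f s 0)) := by
  have hline : Filter.Tendsto (fun t : ℝ => (t : ℂ) * θ) (nhds 0) (nhds 0) := by
    have : Continuous fun t : ℝ => (t : ℂ) * θ := by fun_prop
    simpa using this.tendsto 0
  have e : ((0 : ℝ) : ℂ) * θ = 0 := by simp
  have first : (deriv fun t : ℝ => G (f (t * θ)) (s (t * θ)) (s (t * θ))) =ᶠ[nhds 0]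
      fun t : ℝ => 2 * G (f (t * θ)) (θ • covDeriv G f s (t * θ)) (s (t * θ)) := by
    have hfU : ∀ᶠ z in nhds (0 : ℂ), f z ∈ U :=
      hf.continuousAt.preimage_mem_nhds (h.isOpen.mem_nhds hU)
    filter_upwards [hline.eventually hf.eventually_analyticAt,
      hline.eventually hs.eventually_analyticAt, hline.eventually hfU] with t h1 h2 h3
    have d := h.hasDerivAt_inner_along (γ := fun t : ℝ => f (t * θ)) h3 (hasDerivAt_comp_line h1)
      (hasDerivAt_comp_line h2) (hasDerivAt_comp_line h2)
    rw [d.deriv, h.symm _ h3 (s (t * θ)), hI _ h3, ← smul_add, ← two_mul]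
    rfl
  unfold secondDerivAlong
  rw [first.deriv_eq]
  have d0 := hasDerivAt_comp_line (θ := θ) (t := 0) (f := f) (by rwa [e])
  have d2 := hasDerivAt_comp_line (θ := θ) (t := 0) (f := s) (by rwa [e])
  rw [e] at d0 d2
  have d3 := (h.hasDerivAt_covDeriv_along hf hs hU θ).fun_const_smul θ
  have d4 := (h.hasDerivAt_inner_along (γ := fun t : ℝ => f (t * θ)) (by simpa using hU)
    d0 d3 d2).const_mul 2
  rw [d4.deriv]
  simp only [e, hI _ hU]
  rw [← smul_add θ (deriv s 0)]
  rfl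

/-- The Laplacian of the square norm of a holomorphic vector field `s` along a holomorphic disc `f`:
`Δ |s|² = 4 |∇s|² - 2 R(f', J f', s, J s)`. -/
theorem laplacian_inner {f s : ℂ → V} (hf : AnalyticAt ℂ f 0) (hs : AnalyticAt ℂ s 0)
    (hU : f 0 ∈ U) :
    secondDerivAlong (fun z => G (f z) (s z) (s z)) 1 +
      secondDerivAlong (fun z => G (f z) (s z) (s z)) Complex.I =
      4 * G (f 0) (covDeriv G f s 0) (covDeriv G f s 0)
      - 2 * G (f 0) (curvatureEndo G (f 0) (deriv f 0) (Complex.I • deriv f 0)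
          (Complex.I • s 0)) (s 0) := by
  rw [h.secondDerivAlong_inner hf hs hU 1 (by simp),
    h.secondDerivAlong_inner hf hs hU Complex.I (fun x hx => h.christoffel_I_left hx),
    h.inner_I _ hU, h.curvatureEndo_eq hU]
  simp only [h.christoffel_I_left hU, h.christoffel_I hU, h.fderiv_christoffel_I_left hU,
    h.fderiv_christoffel_I hU, smul_add, smul_smul, one_smul, Complex.I_mul_I, neg_smul, map_add,
    map_sub, map_neg, add_apply, sub_apply, neg_apply]
  ring

omit [FiniteDimensional ℂ V] h

end IsKahlerOn

section Immersion

variable {V' : Type*} [NormedAddCommGroup V'] [NormedSpace ℂ V']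

theorem analyticAt_line (x a : V) : AnalyticAt ℂ (fun z : ℂ => x + z • a) 0 :=
  analyticAt_const.add (analyticAt_id.smul analyticAt_const)

theorem hasDerivAt_line (x a : V) (z : ℂ) : HasDerivAt (fun z : ℂ => x + z • a) a z := by
  simpa using ((hasDerivAt_id z).smul_const a).const_add x

variable {F : V → V'} {x : V}

theorem AnalyticAt.comp_line (hF : AnalyticAt ℂ F x) (a : V) :
    AnalyticAt ℂ (fun z : ℂ => F (x + z • a)) 0 :=
  AnalyticAt.comp_of_eq hF (analyticAt_line x a) (by simp)

theorem AnalyticAt.deriv_comp_line (hF : AnalyticAt ℂ F x) (a : V) :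
    deriv (fun z : ℂ => F (x + z • a)) 0 = fderiv ℂ F x a :=
  (HasFDerivAt.comp_hasDerivAt_of_eq (0 : ℂ) hF.differentiableAt.hasFDerivAt
    (hasDerivAt_line x a 0) (by simp)).deriv

variable [CompleteSpace V']

theorem AnalyticAt.fderiv_apply (hF : AnalyticAt ℂ F x) (c : V) :
    AnalyticAt ℂ (fun y => fderiv ℂ F y c) x :=
  ((ContinuousLinearMap.apply ℂ V' c).analyticAt _).comp hF.fderiv

theorem AnalyticAt.fderiv_fderiv_apply (hF : AnalyticAt ℂ F x) (a c : V) :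
    fderiv ℂ (fun y => fderiv ℂ F y c) x a = fderiv ℂ (fderiv ℂ F) x a c := by
  have h1 := hF.fderiv.differentiableAt.hasFDerivAt.clm_apply (hasFDerivAt_const c x)
  rw [h1.fderiv]
  simp

end Immersion

namespace IsKahlerOn

variable [FiniteDimensional ℂ V] {G : V → V →L[ℝ] V →L[ℝ] ℝ} {U : Set V} (h : IsKahlerOn G U)
  {V' : Type*} [NormedAddCommGroup V'] [NormedSpace ℂ V'] [FiniteDimensional ℂ V']
  {G' : V' → V' →L[ℝ] V' →L[ℝ] ℝ} {U' : Set V'} (h' : IsKahlerOn G' U')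
  {x : V} (hx : x ∈ U) {F : V → V'} (hF : AnalyticAt ℂ F x)
  (hFx : F x ∈ U') (hiso : ∀ᶠ y in nhds x, ∀ u v,
    G y u v = G' (F y) (fderiv ℂ F y u) (fderiv ℂ F y v))
include h h' hx hF hFx hiso

/-- The Levi-Civita connection of a submanifold is the tangential part of the ambient one. -/
theorem inner_christoffel_eq_of_isometry (a c w : V) :
    G x (christoffelCLM G x a c) w =
      G' (F x) (fderiv ℂ (fderiv ℂ F) x a c
        + christoffelCLM G' (F x) (fderiv ℂ F x a) (fderiv ℂ F x c)) (fderiv ℂ F x w) := by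
  have := FiniteDimensional.complete ℂ V'
  set A : V → V → V' := fun a c => fderiv ℂ (fderiv ℂ F) x a c
        + christoffelCLM G' (F x) (fderiv ℂ F x a) (fderiv ℂ F x c) with hA
  have Asymm : ∀ a c, A a c = A c a := by
    intro a c
    simp only [hA]
    rw [h'.christoffel_symm hFx, (hF.contDiffAt (n := 2)).isSymmSndFDerivAt (by simp) a c]
  have compat : ∀ a c w, G x (christoffelCLM G x a c) w + G x c (christoffelCLM G x a w) =
      G' (F x) (A a c) (fderiv ℂ F x w) + G' (F x) (fderiv ℂ F x c) (A a w) := by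
    intro a c w
    have e : ((0 : ℝ) : ℂ) * 1 = 0 := by simp
    have dl := hasDerivAt_comp_line (θ := 1) (t := 0) (by rw [e]; exact analyticAt_line x a)
    have dF := hasDerivAt_comp_line (θ := 1) (t := 0) (by rw [e]; exact hF.comp_line a)
    have dv := fun c => hasDerivAt_comp_line (θ := 1) (t := 0)
      (by rw [e]; exact (hF.fderiv_apply c).comp_line a)
    simp only [e, (hasDerivAt_line x a 0).deriv, hF.deriv_comp_line,
      fun c => (hF.fderiv_apply c).deriv_comp_line a, hF.fderiv_fderiv_apply, one_smul] at dl dF dv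
    have d1 := h.hasDerivAt_inner_along (by simpa using hx) dl (hasDerivAt_const (0 : ℝ) c)
      (hasDerivAt_const (0 : ℝ) w)
    have d2 := h'.hasDerivAt_inner_along (by simpa using hFx) dF (dv c) (dv w)
    have hev : (fun t : ℝ => G (x + ((t : ℂ) * 1) • a) c w) =ᶠ[nhds 0]
        fun t : ℝ => G' (F (x + ((t : ℂ) * 1) • a)) (fderiv ℂ F (x + ((t : ℂ) * 1) • a) c)
          (fderiv ℂ F (x + ((t : ℂ) * 1) • a) w) := by
      have : Filter.Tendsto (fun t : ℝ => x + ((t : ℂ) * 1) • a) (nhds 0) (nhds x) := by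
        have : Continuous fun t : ℝ => x + ((t : ℂ) * 1) • a := by fun_prop
        simpa using this.tendsto 0
      filter_upwards [this.eventually hiso] with t ht using ht c w
    have d3 := d1.unique (d2.congr_of_eventuallyEq hev)
    simpa [hA] using d3
  have s1 : ∀ u v, G x u v = G x v u := h.symm x hx
  have s2 : ∀ u v, G' (F x) u v = G' (F x) v u := h'.symm (F x) hFx
  have Γsymm := h.christoffel_symm hx
  -- The difference of the two sides is symmetric in `a, c` and skew in `c, w`, so it vanishes.
  have k1 := compat a c w
  have k2 := compat c a w
  have k3 := compat w a c
  rw [s1 c, s2 (fderiv ℂ F x c)] at k1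
  rw [s1 a, s2 (fderiv ℂ F x a), Γsymm c a, Asymm c a] at k2
  rw [s1 a, s2 (fderiv ℂ F x a), Γsymm w a, Γsymm w c, Asymm w a, Asymm w c] at k3
  linarith

/-- **Gauss inequality**: the holomorphic bisectional curvature of a complex submanifold is at most
that of the ambient Kähler manifold. -/
theorem bisectional_le_of_isometry (a c : V) :
    G x (curvatureEndo G x a (Complex.I • a) (Complex.I • c)) c ≤
      G' (F x) (curvatureEndo G' (F x) (fderiv ℂ F x a) (Complex.I • fderiv ℂ F x a)
        (Complex.I • fderiv ℂ F x c)) (fderiv ℂ F x c) := by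
  have := FiniteDimensional.complete ℂ V'
  -- Both sides are compared by means of the constant field `c` along the disc `z ↦ x + za`.
  have l1 := h.laplacian_inner (s := fun _ => c) (analyticAt_line x a) analyticAt_const
    (by simpa using hx)
  have l2 := h'.laplacian_inner (hF.comp_line a) ((hF.fderiv_apply c).comp_line a)
    (by simpa using hFx)
  have hev : (fun z : ℂ => G (x + z • a) c c) =ᶠ[nhds 0]
      fun z : ℂ => G' (F (x + z • a)) (fderiv ℂ F (x + z • a) c) (fderiv ℂ F (x + z • a) c) := by
    have : Filter.Tendsto (fun z : ℂ => x + z • a) (nhds 0) (nhds x) := by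
      simpa using (analyticAt_line x a).continuousAt.tendsto
    filter_upwards [this.eventually hiso] with t ht using ht c c
  rw [secondDerivAlong_congr hev, secondDerivAlong_congr hev, l2] at l1
  simp only [covDeriv, (hasDerivAt_line x a 0).deriv, hF.deriv_comp_line,
    (hF.fderiv_apply c).deriv_comp_line a, hF.fderiv_fderiv_apply, deriv_const, zero_add,
    zero_smul, add_zero] at l1
  set P := christoffelCLM G x a c
  set Q := fderiv ℂ (fderiv ℂ F) x a c
        + christoffelCLM G' (F x) (fderiv ℂ F x a) (fderiv ℂ F x c)
  have k1 : G x P P = G' (F x) Q (fderiv ℂ F x P) :=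
    h.inner_christoffel_eq_of_isometry h' hx hF hFx hiso a c P
  have k2 := hiso.self_of_nhds P P
  -- `P` is the orthogonal projection of `Q`, whence `|P| ≤ |Q|`.
  have k3 := h'.inner_nonneg hFx (Q - fderiv ℂ F x P)
  simp only [map_sub, sub_apply] at k3
  rw [h'.symm _ hFx (fderiv ℂ F x P) Q] at k3
  linarith

end IsKahlerOn

end Gauss

/-! ### Algebra of Kähler curvature tensors -/

namespace IsKahlerCurvature

variable {V : Type*} [AddCommGroup V] [Module ℂ V] {T : V → V → V → V → ℝ}
  (h : IsKahlerCurvature T)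
include h

/-- The pair symmetry, from four instances of the Bianchi identity. -/
theorem pair_symm (u v w z : V) : T u v w z = T w z u v := by
  have b1 := h.bianchi u v w z
  have b2 := h.bianchi v w z u
  have b3 := h.bianchi w z u v
  have b4 := h.bianchi z u v w
  linarith [h.antisymm_left u v w z, h.antisymm_right u v w z, h.antisymm_left w z u v,
    h.antisymm_right w z u v, h.antisymm_left v w u z, h.antisymm_right v w u z,
    h.antisymm_left u w v z, h.antisymm_right u w v z, h.antisymm_left w u v z,
    h.antisymm_right w u v z, h.antisymm_left v w z u, h.antisymm_left w z v u,
    h.antisymm_right w z v u, h.antisymm_left z v w u, h.antisymm_right z v w u,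
    h.antisymm_left z u w v, h.antisymm_right z u w v, h.antisymm_right u w z v,
    h.antisymm_left u v z w, h.antisymm_right v z u w, h.antisymm_left v z u w,
    h.antisymm_left u z w v]

theorem antisymm_left' (u v w z : V) : T u v w z = - T v u w z := h.antisymm_left v u w z

theorem add_two (u v v' w z : V) : T u (v + v') w z = T u v w z + T u v' w z := by
  rw [h.antisymm_left', h.add_left, h.antisymm_left' u v, h.antisymm_left' u v']
  ring

theorem smul_two (r : ℝ) (u v w z : V) : T u ((r : ℂ) • v) w z = r * T u v w z := by
  rw [h.antisymm_left', h.smul_left, h.antisymm_left' u v]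
  ring

theorem add_three (u v w w' z : V) : T u v (w + w') z = T u v w z + T u v w' z := by
  rw [h.pair_symm, h.add_left, h.pair_symm w, h.pair_symm w']

theorem smul_three (r : ℝ) (u v w z : V) : T u v ((r : ℂ) • w) z = r * T u v w z := by
  rw [h.pair_symm, h.smul_left, h.pair_symm w]

theorem add_four (u v w z z' : V) : T u v w (z + z') = T u v w z + T u v w z' := by
  rw [h.pair_symm, h.add_two, h.pair_symm w z, h.pair_symm w z']

theorem smul_four (r : ℝ) (u v w z : V) : T u v w ((r : ℂ) • z) = r * T u v w z := by
  rw [h.pair_symm, h.smul_two, h.pair_symm w z]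

theorem neg_left (u v w z : V) : T (-u) v w z = - T u v w z := by
  have := h.smul_left (-1) u v w z
  simpa using this

theorem neg_two (u v w z : V) : T u (-v) w z = - T u v w z := by
  have := h.smul_two (-1) u v w z
  simpa using this

theorem neg_three (u v w z : V) : T u v (-w) z = - T u v w z := by
  have := h.smul_three (-1) u v w z
  simpa using this

theorem neg_four (u v w z : V) : T u v w (-z) = - T u v w z := by
  have := h.smul_four (-1) u v w z
  simpa using this

theorem I_left (u v w z : V) : T (Complex.I • u) (Complex.I • v) w z = T u v w z := by
  rw [h.pair_symm, h.I_right, h.pair_symm]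

theorem I_swap_right (u v w z : V) : T u v (Complex.I • w) z = - T u v w (Complex.I • z) := by
  rw [← h.I_right, smul_smul, Complex.I_mul_I, neg_one_smul, h.neg_three]

theorem I_swap_left (u v w z : V) : T (Complex.I • u) v w z = - T u (Complex.I • v) w z := by
  rw [h.pair_symm, h.I_swap_right, h.pair_symm]

theorem self_left (u w z : V) : T u u w z = 0 := by
  linarith [h.antisymm_left u u w z]

/-- The holomorphic bisectional curvature is symmetric. -/
theorem bisectional_symm (a c : V) :
    T a (Complex.I • a) c (Complex.I • c) = T c (Complex.I • c) a (Complex.I • a) :=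
  h.pair_symm _ _ _ _

/-- The form `(a, b) ↦ T(a, Ib, ·, ·)` is symmetric. -/
theorem I_symm_left (a b w z : V) : T a (Complex.I • b) w z = T b (Complex.I • a) w z := by
  rw [h.antisymm_left', h.I_swap_left, neg_neg]

theorem I_symm_right (a b w z : V) : T w z a (Complex.I • b) = T w z b (Complex.I • a) := by
  rw [h.pair_symm, h.I_symm_left, h.pair_symm]

theorem bisectional_smul_right (ζ : ℂ) (a c : V) :
    T a (Complex.I • a) (ζ • c) (Complex.I • ζ • c) =
      ‖ζ‖ ^ 2 * T a (Complex.I • a) c (Complex.I • c) := by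
  have e : ζ • c = (ζ.re : ℂ) • c + (ζ.im : ℂ) • Complex.I • c := by
    rw [smul_smul, ← add_smul, Complex.re_add_im]
  have hnorm : ‖ζ‖ ^ 2 = ζ.re ^ 2 + ζ.im ^ 2 := by
    rw [Complex.sq_norm, Complex.normSq_apply]; ring
  have hself : T a (Complex.I • a) c c = 0 := by rw [h.pair_symm, h.self_left]
  have hself2 : T a (Complex.I • a) (Complex.I • c) (Complex.I • c) = 0 := by
    rw [h.I_right, hself]
  have hneg : Complex.I • Complex.I • c = -c := by
    rw [smul_smul, Complex.I_mul_I, neg_one_smul]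
  have hanti := h.antisymm_right a (Complex.I • a) c (Complex.I • c)
  rw [e, smul_add, smul_comm Complex.I (ζ.re : ℂ), smul_comm Complex.I (ζ.im : ℂ), hneg, hnorm]
  simp only [h.add_three, h.add_four, h.smul_three, h.smul_four, h.neg_four, hself, hself2, hanti]
  ring

theorem bisectional_smul_left (ζ : ℂ) (a c : V) :
    T (ζ • a) (Complex.I • ζ • a) c (Complex.I • c) =
      ‖ζ‖ ^ 2 * T a (Complex.I • a) c (Complex.I • c) := by
  rw [h.bisectional_symm, h.bisectional_smul_right, h.bisectional_symm]

/-- The bisectional curvature is a sum of two sectional curvatures. -/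
theorem bisectional_eq_add (a c : V) :
    T a (Complex.I • a) c (Complex.I • c) =
      T a c a c + T (Complex.I • a) c (Complex.I • a) c := by
  have b := h.bianchi a (Complex.I • a) c (Complex.I • c)
  have e1 : T (Complex.I • a) c a (Complex.I • c) = - T (Complex.I • a) c (Complex.I • a) c := by
    rw [h.I_swap_right, neg_neg]
  have e2 : T c a (Complex.I • a) (Complex.I • c) = - T a c a c := by
    rw [h.I_right, h.antisymm_left]
  linarith

/-- In the Hermitian form that `T` induces on the symmetric square, the products
`(αe + βf)(αe - βf)` and `(βe + αIf)(βe - αIf)` are orthogonal, of equal length, and span the same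
plane as `e²` and `f²`. -/
theorem bisectional_add_bisectional (α β : ℝ) (e f : V) :
    T ((α : ℂ) • e + (β : ℂ) • f) (Complex.I • ((α : ℂ) • e + (β : ℂ) • f))
        ((α : ℂ) • e - (β : ℂ) • f) (Complex.I • ((α : ℂ) • e - (β : ℂ) • f))
      + T ((β : ℂ) • e + (α : ℂ) • Complex.I • f)
        (Complex.I • ((β : ℂ) • e + (α : ℂ) • Complex.I • f))
        ((β : ℂ) • e - (α : ℂ) • Complex.I • f)
        (Complex.I • ((β : ℂ) • e - (α : ℂ) • Complex.I • f)) =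
      (α ^ 4 + β ^ 4) * (T e (Complex.I • e) e (Complex.I • e)
        + T f (Complex.I • f) f (Complex.I • f)) := by
  have expand : ∀ (r t : ℝ) (v : V),
      T ((r : ℂ) • e + (t : ℂ) • v) (Complex.I • ((r : ℂ) • e + (t : ℂ) • v))
        ((r : ℂ) • e - (t : ℂ) • v) (Complex.I • ((r : ℂ) • e - (t : ℂ) • v)) =
      r ^ 4 * T e (Complex.I • e) e (Complex.I • e) + t ^ 4 * T v (Complex.I • v) v (Complex.I • v)
      + r ^ 2 * t ^ 2 * (2 * T e (Complex.I • e) v (Complex.I • v)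
        - 4 * T e (Complex.I • v) e (Complex.I • v)) := by
    intro r t v
    simp only [sub_eq_add_neg, smul_add, smul_neg, smul_comm Complex.I (r : ℂ),
      smul_comm Complex.I (t : ℂ), h.add_left, h.add_two, h.add_three, h.add_four, h.smul_left,
      h.smul_two, h.smul_three, h.smul_four, h.neg_three, h.neg_four]
    simp only [h.I_symm_left v e, fun w z => h.I_symm_right v e w z,
      h.pair_symm v (Complex.I • v) e, h.pair_symm e (Complex.I • v) e (Complex.I • e)]
    ring
  have e1 : T (Complex.I • f) (Complex.I • Complex.I • f) (Complex.I • f)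
      (Complex.I • Complex.I • f) = T f (Complex.I • f) f (Complex.I • f) := by
    rw [h.I_left, h.I_right]
  have e2 : T e (Complex.I • e) (Complex.I • f) (Complex.I • Complex.I • f) =
      T e (Complex.I • e) f (Complex.I • f) := h.I_right _ _ _ _
  have e3 : T e (Complex.I • Complex.I • f) e (Complex.I • Complex.I • f) = T e f e f := by
    rw [smul_smul, Complex.I_mul_I, neg_one_smul, h.neg_two, h.neg_four, neg_neg]
  have e4 : T e (Complex.I • e) f (Complex.I • f) =
      T e f e f + T e (Complex.I • f) e (Complex.I • f) := by
    rw [h.bisectional_eq_add, h.I_swap_left, h.I_swap_right, neg_neg]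
  rw [expand, expand, e1, e2, e3, e4]
  ring

/-- The pull-back of a Kähler curvature tensor by a complex linear map. -/
theorem comp {W : Type*} [AddCommGroup W] [Module ℂ W] (Φ : W →ₗ[ℂ] V) :
    IsKahlerCurvature fun u v w z => T (Φ u) (Φ v) (Φ w) (Φ z) where
  add_left u u' v w z := by rw [map_add, h.add_left]
  smul_left r u v w z := by rw [map_smul, h.smul_left]
  antisymm_left u v w z := h.antisymm_left _ _ _ _
  antisymm_right u v w z := h.antisymm_right _ _ _ _
  bianchi u v w z := h.bianchi _ _ _ _
  I_right u v w z := by rw [map_smul, map_smul, h.I_right]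

end IsKahlerCurvature

/-! ### Bisectional curvature and the trace -/

section Trace

variable {H : Type*} [NormedAddCommGroup H] [InnerProductSpace ℂ H] [FiniteDimensional ℂ H]
  {n : ℕ}

theorem sum_one_add_delta (K : ℝ) :
    ∑ i : Fin n, ∑ j : Fin n, K * (1 + if i = j then (1 : ℝ) else 0) = K * ((n : ℝ) ^ 2 + n) := by
  simp only [← Finset.mul_sum, Finset.sum_add_distrib, Finset.sum_ite_eq, Finset.mem_univ, if_true]
  simp
  ring_nf
  simp

namespace IsKahlerCurvature

variable {T : H → H → H → H → ℝ} (h : IsKahlerCurvature T) {K s : ℝ}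
  (hK : ∀ a c, T a (Complex.I • a) c (Complex.I • c) ≤
    K * (‖a‖ ^ 2 * ‖c‖ ^ 2 + ‖inner ℂ a c‖ ^ 2))
  (hs : ∀ b : OrthonormalBasis (Fin n) ℂ H,
    ∑ i, ∑ j, T (b i) (Complex.I • b i) (b j) (Complex.I • b j) = s)
include hK hs

omit [FiniteDimensional ℂ H] in
/-- The terms `K (1 + δᵢⱼ) - T(eᵢ, Ieᵢ, eⱼ, Ieⱼ)` are nonnegative, so that the sum of some diagonal
ones is at most the sum of all. -/
theorem sum_defect_le (b : OrthonormalBasis (Fin n) ℂ H) (S : Finset (Fin n)) :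
    ∑ i ∈ S, (2 * K - T (b i) (Complex.I • b i) (b i) (Complex.I • b i)) ≤
      K * ((n : ℝ) ^ 2 + n) - s := by
  have hinner : ∀ i j, ‖b i‖ ^ 2 * ‖b j‖ ^ 2 + ‖inner ℂ (b i) (b j)‖ ^ 2 =
      1 + if i = j then (1 : ℝ) else 0 := by
    intro i j
    rw [b.norm_eq_one, b.norm_eq_one, b.inner_eq_ite]
    split_ifs <;> simp
  have hnn : ∀ i j, 0 ≤ K * (1 + if i = j then (1 : ℝ) else 0)
      - T (b i) (Complex.I • b i) (b j) (Complex.I • b j) := by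
    intro i j
    have := hK (b i) (b j)
    rw [hinner] at this
    linarith
  calc _ = ∑ i ∈ S, (K * (1 + if i = i then (1 : ℝ) else 0)
      - T (b i) (Complex.I • b i) (b i) (Complex.I • b i)) := by
        refine Finset.sum_congr rfl fun i _ => ?_
        rw [if_pos rfl]; ring
    _ ≤ ∑ i ∈ S, ∑ j, (K * (1 + if i = j then (1 : ℝ) else 0)
      - T (b i) (Complex.I • b i) (b j) (Complex.I • b j)) :=
        Finset.sum_le_sum fun i _ => Finset.single_le_sum (f := fun j =>
          K * (1 + if i = j then (1 : ℝ) else 0)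
          - T (b i) (Complex.I • b i) (b j) (Complex.I • b j)) (fun j _ => hnn i j)
          (Finset.mem_univ i)
    _ ≤ ∑ i, ∑ j, (K * (1 + if i = j then (1 : ℝ) else 0)
      - T (b i) (Complex.I • b i) (b j) (Complex.I • b j)) :=
        Finset.sum_le_sum_of_subset_of_nonneg (Finset.subset_univ S)
          fun i _ _ => Finset.sum_nonneg fun j _ => hnn i j
    _ = _ := by
        simp only [Finset.sum_sub_distrib]
        rw [hs b, sum_one_add_delta]

variable (hn : Module.finrank ℂ H = n)
include hn

theorem le_self_of_unit {x : H} (hx : ‖x‖ = 1) :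
    s - K * ((n : ℝ) ^ 2 + n - 2) ≤ T x (Complex.I • x) x (Complex.I • x) := by
  have hpos : 0 < n := by
    rw [← hn]
    have : Nontrivial H := ⟨x, 0, by rintro rfl; simp at hx⟩
    exact Module.finrank_pos
  have ho : Orthonormal ℂ (Set.domRestrict {(⟨0, hpos⟩ : Fin n)} fun _ => x) :=
    ⟨fun _ => hx, fun i j hij => (hij (Subsingleton.elim i j)).elim⟩
  obtain ⟨b, hb⟩ := ho.exists_orthonormalBasis_extension_of_card_eq (by simpa using hn)
  have := sum_defect_le hK hs b {⟨0, hpos⟩}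
  rw [Finset.sum_singleton, hb _ rfl] at this
  linarith

theorem le_add_of_orthonormal {e f : H} (he : ‖e‖ = 1) (hf : ‖f‖ = 1) (hef : inner ℂ e f = 0) :
    s - K * ((n : ℝ) ^ 2 + n - 4) ≤
      T e (Complex.I • e) e (Complex.I • e) + T f (Complex.I • f) f (Complex.I • f) := by
  have ho2 : Orthonormal ℂ ![e, f] := by
    rw [orthonormal_iff_ite]
    have hfe : inner ℂ f e = 0 := inner_eq_zero_symm.1 hef
    intro i j
    fin_cases i <;> fin_cases j <;> simp [hef, hfe, inner_self_eq_norm_sq_to_K, he, hf]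
  have h2 : 2 ≤ n := by
    rw [← hn]; simpa using ho2.linearIndependent.fintype_card_le_finrank
  let k : Fin 2 → Fin n := Fin.castLE h2
  have hk : Function.Injective k := Fin.castLE_injective h2
  let v : Fin n → H := fun i => if i = k 0 then e else f
  have hv0 : v (k 0) = e := if_pos rfl
  have hv1 : v (k 1) = f := if_neg fun hc => by simpa using hk hc
  have hne : k 0 ≠ k 1 := fun hc => by simpa using hk hc
  have ho : Orthonormal ℂ (Set.domRestrict {k 0, k 1} v) := by
    refine ⟨?_, ?_⟩
    · rintro ⟨i, rfl | rfl⟩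
      · simpa [hv0] using he
      · simpa [hv1] using hf
    · rintro ⟨i, rfl | rfl⟩ ⟨j, rfl | rfl⟩ hij
      · exact (hij rfl).elim
      · simpa [hv0, hv1] using hef
      · simpa [hv0, hv1] using inner_eq_zero_symm.1 hef
      · exact (hij rfl).elim
  obtain ⟨b, hb⟩ := ho.exists_orthonormalBasis_extension_of_card_eq (by simpa using hn)
  have := sum_defect_le hK hs b {k 0, k 1}
  rw [Finset.sum_pair hne, hb _ (by simp), hb _ (by simp), hv0, hv1] at this
  linarith

include h

/-- The lower bound for unit vectors whose Hermitian product is real. -/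
theorem le_of_unit_of_real {x y : H} (hx : ‖x‖ = 1) (hy : ‖y‖ = 1) {r : ℝ}
    (hr : inner ℂ x y = (r : ℂ)) :
    (s / 2 - ((n : ℝ) ^ 2 + n - 2) / 2 * K) * (1 + r ^ 2) ≤
      T x (Complex.I • x) y (Complex.I • y) := by
  have hyx : inner ℂ y x = (r : ℂ) := by rw [← inner_conj_symm, hr, Complex.conj_ofReal]
  have hxx : inner ℂ x x = (1 : ℂ) := by rw [inner_self_eq_norm_sq_to_K, hx]; simp
  have hyy : inner ℂ y y = (1 : ℂ) := by rw [inner_self_eq_norm_sq_to_K, hy]; simp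
  -- If `x = ± y`, one member of a unitary basis suffices.
  rcases eq_or_ne (x - y) 0 with hM | hM
  · have hxy : y = x := (sub_eq_zero.1 hM).symm
    subst hxy
    rw [hxx] at hr
    have hr1 : r = 1 := by exact_mod_cast hr.symm
    have := le_self_of_unit hK hs hn hx
    rw [hr1]
    linarith
  rcases eq_or_ne (x + y) 0 with hP | hP
  · have hxy : y = -x := (neg_eq_of_add_eq_zero_right hP).symm
    subst hxy
    rw [inner_neg_right, hxx] at hr
    have hr1 : r = -1 := by exact_mod_cast hr.symm
    have := le_self_of_unit hK hs hn hx
    rw [hr1, smul_neg, h.neg_three, h.neg_four, neg_neg]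
    linarith
  -- As `⟨x, y⟩` is real, `x + y` and `x - y` are orthogonal: `x = αe + βf` and `y = αe - βf` with
  -- `α`, `β` real and `e`, `f` orthonormal.
  have hP0 : ‖x + y‖ ≠ 0 := norm_ne_zero_iff.2 hP
  have hM0 : ‖x - y‖ ≠ 0 := norm_ne_zero_iff.2 hM
  have hPsq : ‖x + y‖ ^ 2 = 2 + 2 * r := by
    have := inner_self_eq_norm_sq_to_K (𝕜 := ℂ) (x + y)
    simp only [inner_add_left, inner_add_right, hxx, hyy, hr, hyx] at this
    have h2 : ((‖x + y‖ ^ 2 : ℝ) : ℂ) = ((2 + 2 * r : ℝ) : ℂ) := by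
      push_cast; exact this.symm.trans (by ring)
    exact_mod_cast h2
  have hMsq : ‖x - y‖ ^ 2 = 2 - 2 * r := by
    have := inner_self_eq_norm_sq_to_K (𝕜 := ℂ) (x - y)
    simp only [inner_sub_left, inner_sub_right, hxx, hyy, hr, hyx] at this
    have h2 : ((‖x - y‖ ^ 2 : ℝ) : ℂ) = ((2 - 2 * r : ℝ) : ℂ) := by
      push_cast; exact this.symm.trans (by ring)
    exact_mod_cast h2
  set α : ℝ := ‖x + y‖ / 2 with hα
  set β : ℝ := ‖x - y‖ / 2 with hβ
  set e : H := ((‖x + y‖⁻¹ : ℝ) : ℂ) • (x + y) with he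
  set f : H := ((‖x - y‖⁻¹ : ℝ) : ℂ) • (x - y) with hf
  have hα2 : α ^ 2 = (1 + r) / 2 := by rw [hα, div_pow, hPsq]; ring
  have hβ2 : β ^ 2 = (1 - r) / 2 := by rw [hβ, div_pow, hMsq]; ring
  have he1 : ‖e‖ = 1 := by
    rw [he, norm_smul, Complex.norm_real, norm_inv, norm_norm, inv_mul_cancel₀ hP0]
  have hf1 : ‖f‖ = 1 := by
    rw [hf, norm_smul, Complex.norm_real, norm_inv, norm_norm, inv_mul_cancel₀ hM0]
  have hef : inner ℂ e f = 0 := by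
    rw [he, hf, inner_smul_left, inner_smul_right]
    simp only [inner_add_left, inner_sub_right, hxx, hyy, hr, hyx]
    ring
  have hαe : (α : ℂ) • e = (2⁻¹ : ℂ) • (x + y) := by
    rw [he, smul_smul, ← Complex.ofReal_mul, hα, div_mul_eq_mul_div, mul_inv_cancel₀ hP0]
    norm_num
  have hβf : (β : ℂ) • f = (2⁻¹ : ℂ) • (x - y) := by
    rw [hf, smul_smul, ← Complex.ofReal_mul, hβ, div_mul_eq_mul_div, mul_inv_cancel₀ hM0]
    norm_num
  have hxe : x = (α : ℂ) • e + (β : ℂ) • f := by rw [hαe, hβf]; module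
  have hye : y = (α : ℂ) • e - (β : ℂ) • f := by rw [hαe, hβf]; module
  have key := h.bisectional_add_bisectional α β e f
  rw [← hxe, ← hye] at key
  have hee : inner ℂ e e = (1 : ℂ) := by rw [inner_self_eq_norm_sq_to_K, he1]; simp
  have hff : inner ℂ f f = (1 : ℂ) := by rw [inner_self_eq_norm_sq_to_K, hf1]; simp
  have hfe : inner ℂ f e = 0 := inner_eq_zero_symm.1 hef
  set x' := (β : ℂ) • e + (α : ℂ) • Complex.I • f with hx'
  set y' := (β : ℂ) • e - (α : ℂ) • Complex.I • f with hy'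
  have hab : α ^ 2 + β ^ 2 = 1 := by rw [hα2, hβ2]; ring
  have nx : ‖x'‖ ^ 2 = 1 := by
    have := inner_self_eq_norm_sq_to_K (𝕜 := ℂ) x'
    rw [hx'] at this
    simp only [inner_add_left, inner_add_right, inner_smul_left, inner_smul_right, hee, hff, hef,
      hfe, Complex.conj_ofReal, Complex.conj_I] at this
    have h2 : ((‖x'‖ ^ 2 : ℝ) : ℂ) = ((α ^ 2 + β ^ 2 : ℝ) : ℂ) := by
      push_cast
      exact this.symm.trans (by linear_combination -(α : ℂ) ^ 2 * Complex.I_sq)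
    rw [hab] at h2
    exact_mod_cast h2
  have ny : ‖y'‖ ^ 2 = 1 := by
    have := inner_self_eq_norm_sq_to_K (𝕜 := ℂ) y'
    rw [hy'] at this
    simp only [inner_sub_left, inner_sub_right, inner_smul_left, inner_smul_right, hee, hff, hef,
      hfe, Complex.conj_ofReal, Complex.conj_I] at this
    have h2 : ((‖y'‖ ^ 2 : ℝ) : ℂ) = ((α ^ 2 + β ^ 2 : ℝ) : ℂ) := by
      push_cast
      exact this.symm.trans (by linear_combination -(α : ℂ) ^ 2 * Complex.I_sq)
    rw [hab] at h2
    exact_mod_cast h2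
  have nxy : inner ℂ x' y' = ((-r : ℝ) : ℂ) := by
    have : -r = β ^ 2 - α ^ 2 := by rw [hα2, hβ2]; ring
    rw [hx', hy', this]
    simp only [inner_add_left, inner_sub_right, inner_smul_left, inner_smul_right, hee, hff, hef,
      hfe, Complex.conj_ofReal, Complex.conj_I]
    push_cast
    linear_combination (α : ℂ) ^ 2 * Complex.I_sq
  have up := hK x' y'
  rw [nx, ny, nxy, Complex.norm_real, Real.norm_eq_abs, sq_abs, neg_sq] at up
  have lo := le_add_of_orthonormal hK hs hn he1 hf1 hef
  have h4 : α ^ 4 + β ^ 4 = (1 + r ^ 2) / 2 := by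
    have : α ^ 4 + β ^ 4 = (α ^ 2) ^ 2 + (β ^ 2) ^ 2 := by ring
    rw [this, hα2, hβ2]; ring
  rw [h4] at key
  have := mul_le_mul_of_nonneg_left lo (by positivity : 0 ≤ (1 + r ^ 2) / 2)
  linarith

/-- An upper bound for the bisectional curvatures and the trace `s` bound them from below. -/
theorem le_bisectional (x y : H) :
    (s / 2 - ((n : ℝ) ^ 2 + n - 2) / 2 * K) * (‖x‖ ^ 2 * ‖y‖ ^ 2 + ‖inner ℂ x y‖ ^ 2) ≤
      T x (Complex.I • x) y (Complex.I • y) := by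
  rcases eq_or_ne x 0 with rfl | hx
  · have := h.bisectional_smul_left 0 0 y
    rw [zero_smul, norm_zero] at this
    rw [this]
    simp
  rcases eq_or_ne y 0 with rfl | hy
  · have := h.bisectional_smul_right 0 x 0
    rw [zero_smul, norm_zero] at this
    rw [this]
    simp
  have hx0 : ‖x‖ ≠ 0 := norm_ne_zero_iff.2 hx
  have hy0 : ‖y‖ ≠ 0 := norm_ne_zero_iff.2 hy
  -- Multiplication of `y` by a phase makes the Hermitian product real.
  obtain ⟨ζ, hζ, hζe⟩ := RCLike.exists_norm_eq_mul_self (inner ℂ x y)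
  set x₀ : H := ((‖x‖⁻¹ : ℝ) : ℂ) • x with hx₀
  set y₀ : H := (ζ * (‖y‖⁻¹ : ℝ)) • y with hy₀
  have n1 : ‖x₀‖ = 1 := by
    rw [hx₀, norm_smul, Complex.norm_real, norm_inv, norm_norm, inv_mul_cancel₀ hx0]
  have n2 : ‖y₀‖ = 1 := by
    rw [hy₀, norm_smul, norm_mul, hζ, Complex.norm_real, norm_inv, norm_norm, one_mul,
      inv_mul_cancel₀ hy0]
  have n3 : inner ℂ x₀ y₀ = ((‖x‖⁻¹ * ‖y‖⁻¹ * ‖inner ℂ x y‖ : ℝ) : ℂ) := by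
    rw [hx₀, hy₀, inner_smul_left, inner_smul_right, Complex.conj_ofReal]
    push_cast
    have : ((‖inner ℂ x y‖ : ℝ) : ℂ) = ζ * inner ℂ x y := hζe
    rw [this]
    ring
  have key := h.le_of_unit_of_real hK hs hn n1 n2 n3
  rw [hx₀, hy₀, h.bisectional_smul_left, h.bisectional_smul_right, norm_mul, hζ, Complex.norm_real,
    Complex.norm_real, norm_inv, norm_inv, norm_norm, norm_norm, one_mul] at key
  have := mul_le_mul_of_nonneg_left key (by positivity : 0 ≤ ‖x‖ ^ 2 * ‖y‖ ^ 2)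
  calc _ = ‖x‖ ^ 2 * ‖y‖ ^ 2 * ((s / 2 - ((n : ℝ) ^ 2 + n - 2) / 2 * K) *
        (1 + (‖x‖⁻¹ * ‖y‖⁻¹ * ‖inner ℂ x y‖) ^ 2)) := by field_simp
    _ ≤ _ := this
    _ = _ := by field_simp

end IsKahlerCurvature

end Trace

/-! ### Traces in unitary bases -/

section MetricTrace

/-- The trace of a bilinear form is computed by any orthonormal basis. -/
theorem metricTrace_eq_sum {V : Type*} [NormedAddCommGroup V] [NormedSpace ℝ V]
    [FiniteDimensional ℝ V] {κ : Type*} [Fintype κ] (f : Module.Basis κ ℝ V)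
    (g β : V →ₗ[ℝ] V →ₗ[ℝ] ℝ) (hf : ∀ k, g (f k) (f k) = 1) (hf' : ∀ k l, k ≠ l → g (f k) (f l) = 0) :
    metricTrace (fun a b => g a b) (fun a b => β a b) = ∑ k, β (f k) (f k) := by
  classical
  have hff : ∀ k l, g (f k) (f l) = if k = l then 1 else 0 := by
    intro k l
    split_ifs with hkl
    · rw [hkl, hf]
    · exact hf' k l hkl
  unfold metricTrace
  set b := Module.finBasis ℝ V with hb
  -- `P` expresses `b` in terms of `f`, and `C` is the inverse change of basis.
  set P : Matrix (Fin (Module.finrank ℝ V)) κ ℝ := (f.toMatrix b).transpose with hP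
  set C : Matrix κ (Fin (Module.finrank ℝ V)) ℝ := (b.toMatrix f).transpose with hC
  have hCP : C * P = 1 := by
    rw [hC, hP, ← Matrix.transpose_mul, f.toMatrix_mul_toMatrix_flip, Matrix.transpose_one]
  have hPC : P * C = 1 := by
    rw [hC, hP, ← Matrix.transpose_mul, b.toMatrix_mul_toMatrix_flip, Matrix.transpose_one]
  have hbf : ∀ i, b i = ∑ k, P i k • f k := fun i => (f.sum_toMatrix_smul_self b i).symm
  have hfb : ∀ k, f k = ∑ i, C k i • b i := fun k => (b.sum_toMatrix_smul_self f k).symm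
  have hgram : (Matrix.of fun i j => g (b i) (b j)) = P * P.transpose := by
    ext i j
    rw [Matrix.of_apply, hbf i, hbf j]
    simp only [map_sum, map_smul, LinearMap.sum_apply, LinearMap.smul_apply, hff, smul_eq_mul,
      Matrix.mul_apply, Matrix.transpose_apply, mul_ite, mul_one, mul_zero,
      Finset.sum_ite_eq', Finset.mem_univ, if_true]
    exact Finset.sum_congr rfl fun k _ => mul_comm _ _
  have hinv : (Matrix.of fun i j => g (b i) (b j))⁻¹ = C.transpose * C := by
    refine Matrix.inv_eq_right_inv ?_
    rw [hgram, Matrix.mul_assoc, ← Matrix.mul_assoc P.transpose, ← Matrix.transpose_mul, hCP,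
      Matrix.transpose_one, Matrix.one_mul, hPC]
  simp only [hinv]
  have hβ : ∀ k, β (f k) (f k) = ∑ i, ∑ j, C k i * C k j * β (b i) (b j) := by
    intro k
    conv_lhs => rw [hfb k]
    simp only [map_sum, map_smul, LinearMap.sum_apply, LinearMap.smul_apply, smul_eq_mul,
      Finset.mul_sum]
    rw [Finset.sum_comm]
    exact Finset.sum_congr rfl fun i _ => Finset.sum_congr rfl fun j _ => by ring
  simp only [hβ, Matrix.mul_apply, Matrix.transpose_apply, Finset.sum_mul]
  rw [Finset.sum_comm' (t' := Finset.univ) (s' := fun _ => Finset.univ) (by simp)]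
  conv_rhs => rw [Finset.sum_comm]
  rw [Finset.sum_comm]
  refine Finset.sum_congr rfl fun i _ => ?_
  rw [Finset.sum_comm]

/-- A linear isomorphism of a Hermitian vector space `V` with a standard one.  The Hermitian product
of `V` is described by its real part `g`. -/
theorem exists_linearEquiv_of_inner {V : Type*} [AddCommGroup V] [Module ℂ V] [FiniteDimensional ℂ V]
    (g : V →ₗ[ℝ] V →ₗ[ℝ] ℝ) (hsymm : ∀ u v, g u v = g v u) (hpos : ∀ v, v ≠ 0 → 0 < g v v)
    (hI : ∀ u v, g (Complex.I • u) (Complex.I • v) = g u v) :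
    ∃ Φ : EuclideanSpace ℂ (Fin (Module.finrank ℂ V)) ≃ₗ[ℂ] V,
      ∀ u v, g (Φ u) (Φ v) = (inner ℂ u v).re := by
  have hIl : ∀ u v, g (Complex.I • u) v = - g u (Complex.I • v) := by
    intro u v
    have := hI u (Complex.I • v)
    rw [smul_smul, Complex.I_mul_I, neg_one_smul, map_neg] at this
    linarith
  have hII : ∀ v : V, Complex.I • Complex.I • v = -v := by
    intro v
    rw [smul_smul, Complex.I_mul_I, neg_one_smul]
  have hsmul : ∀ (r : ℂ) (v : V), r • v = r.re • v + r.im • Complex.I • v := by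
    intro r v
    rw [← Complex.coe_smul, ← Complex.coe_smul, smul_smul, ← add_smul, Complex.re_add_im]
  let core : InnerProductSpace.Core ℂ V :=
    { inner := fun u v => ⟨g u v, - g u (Complex.I • v)⟩
      conj_inner_symm := fun u v => by
        apply Complex.ext
        · simp [hsymm u v]
        · simp only [Complex.conj_im]
          rw [hsymm v, hIl]
          ring
      re_inner_nonneg := fun v => by
        rcases eq_or_ne v 0 with rfl | hv
        · simp
        · exact (hpos v hv).le
      add_left := fun u v w => by
        apply Complex.ext
        · simp
        · simp; ring
      smul_left := fun u v r => by
        rw [hsmul r u]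
        apply Complex.ext
        · simp [hIl]; ring
        · simp [hIl, hII]; ring
      definite := fun v hv => by
        by_contra hne
        have h1 : g v v = 0 := congrArg Complex.re hv
        exact (hpos v hne).ne' h1 }
  let : NormedAddCommGroup V := core.toNormedAddCommGroup
  let : InnerProductSpace ℂ V := InnerProductSpace.ofCore core.toCore
  let b := stdOrthonormalBasis ℂ V
  refine ⟨b.repr.symm.toLinearEquiv, fun u v => ?_⟩
  rw [← b.repr.symm.inner_map_map u v]
  rfl

variable {V : Type*} [NormedAddCommGroup V] [NormedSpace ℂ V] [FiniteDimensional ℂ V]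
  {H : Type*} [NormedAddCommGroup H] [InnerProductSpace ℂ H] {ι : Type*} [Fintype ι]

/-- The trace of a bilinear form in terms of a unitary basis. -/
theorem metricTrace_eq_sum_unitary (g β : V →ₗ[ℝ] V →ₗ[ℝ] ℝ) (Φ : H ≃ₗ[ℂ] V)
    (hΦ : ∀ u v, g (Φ u) (Φ v) = (inner ℂ u v).re) (b : OrthonormalBasis ι ℂ H) :
    metricTrace (fun a b => g a b) (fun a b => β a b) =
      ∑ i, (β (Φ (b i)) (Φ (b i)) + β (Complex.I • Φ (b i)) (Complex.I • Φ (b i))) := by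
  classical
  let f : Module.Basis (Fin 2 × ι) ℝ V :=
    Complex.basisOneI.smulTower (b.toBasis.map Φ)
  have hf : ∀ j i, f (j, i) = Φ (Complex.basisOneI j • b i) := by
    intro j i
    simp [f, Module.Basis.smulTower_apply]
  have hbb := b.inner_eq_ite
  rw [metricTrace_eq_sum f g β]
  · rw [Fintype.sum_prod_type]
    simp only [hf, Fin.sum_univ_two, Complex.coe_basisOneI, Matrix.cons_val_zero,
      Matrix.cons_val_one, one_smul, map_smul, Finset.sum_add_distrib]
  · rintro ⟨j, i⟩
    rw [hf, hΦ, inner_smul_left, inner_smul_right, hbb]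
    fin_cases j <;> simp
  · rintro ⟨j, i⟩ ⟨j', i'⟩ hne
    rw [hf, hf, hΦ, inner_smul_left, inner_smul_right, hbb]
    split_ifs with hii
    · subst hii
      fin_cases j <;> fin_cases j' <;> simp at hne ⊢
    · simp

namespace IsKahlerCurvature

variable {T : V → V → V → V → ℝ} (h : IsKahlerCurvature T) (g : V →ₗ[ℝ] V →ₗ[ℝ] ℝ) (Φ : H ≃ₗ[ℂ] V)
    (hΦ : ∀ u v, g (Φ u) (Φ v) = (inner ℂ u v).re) (b : OrthonormalBasis ι ℂ H)

/-- The bilinear form `T(·, v, ·, w)`. -/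
noncomputable def bilinOdd (h : IsKahlerCurvature T) (v w : V) : V →ₗ[ℝ] V →ₗ[ℝ] ℝ :=
  LinearMap.mk₂ ℝ (fun a b => T a v b w) (fun _ _ _ => h.add_left _ _ _ _ _)
    (fun r a b => by simpa using h.smul_left r a v b w) (fun _ _ _ => h.add_three _ _ _ _ _)
    (fun r a b => by simpa using h.smul_three r a v b w)

/-- The bilinear form `T(a, ·, b, ·)`. -/
noncomputable def bilinEven (h : IsKahlerCurvature T) (a b : V) : V →ₗ[ℝ] V →ₗ[ℝ] ℝ :=
  LinearMap.mk₂ ℝ (fun v w => T a v b w) (fun _ _ _ => h.add_two _ _ _ _ _)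
    (fun r v w => by simpa using h.smul_two r a v b w) (fun _ _ _ => h.add_four _ _ _ _ _)
    (fun r v w => by simpa using h.smul_four r a v b w)

include h hΦ

theorem ricci_eq_sum (v w : V) :
    metricTrace (fun a b => g a b) (fun a b => T a v b w) =
      ∑ i, (T (Φ (b i)) v (Φ (b i)) w + T (Complex.I • Φ (b i)) v (Complex.I • Φ (b i)) w) :=
  metricTrace_eq_sum_unitary g (h.bilinOdd v w) Φ hΦ b

/-- The Ricci curvature is a sum of bisectional curvatures. -/
theorem ricci_self_eq_sum (v : V) :
    metricTrace (fun a b => g a b) (fun a b => T a v b v) =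
      ∑ i, T (Φ (b i)) (Complex.I • Φ (b i)) v (Complex.I • v) := by
  rw [h.ricci_eq_sum g Φ hΦ b]
  simp only [h.bisectional_eq_add]

/-- The scalar curvature is twice the sum of the bisectional curvatures of a unitary frame. -/
theorem scalar_eq_sum :
    metricTrace (fun a b => g a b)
      (fun v w => metricTrace (fun a b => g a b) (fun a b => T a v b w)) =
      2 * ∑ i, ∑ j, T (Φ (b i)) (Complex.I • Φ (b i)) (Φ (b j)) (Complex.I • Φ (b j)) := by
  have key := metricTrace_eq_sum_unitary g (∑ i, (h.bilinEven (Φ (b i)) (Φ (b i)) +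
    h.bilinEven (Complex.I • Φ (b i)) (Complex.I • Φ (b i)))) Φ hΦ b
  have e : ∀ v w, (∑ i, (h.bilinEven (Φ (b i)) (Φ (b i)) +
    h.bilinEven (Complex.I • Φ (b i)) (Complex.I • Φ (b i)))) v w =
      metricTrace (fun a b => g a b) (fun a b => T a v b w) := by
    intro v w
    rw [h.ricci_eq_sum g Φ hΦ b]
    simp [bilinEven, LinearMap.sum_apply]
  simp only [e] at key
  rw [key]
  simp only [h.ricci_self_eq_sum g Φ hΦ b, h.I_right, ← two_mul, ← Finset.mul_sum]
  rw [Finset.sum_comm]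

end IsKahlerCurvature

end MetricTrace

/-! ### Coordinate expressions of Kähler metrics and of holomorphic isometries -/

section ChartExpression

set_option maxSynthPendingDepth 3

variable {E : Type*} [NormedAddCommGroup E] [NormedSpace ℂ E]
  {M : Type*} [TopologicalSpace M] [ChartedSpace E M]
  {E' : Type*} [NormedAddCommGroup E'] [NormedSpace ℂ E']
  {M' : Type*} [TopologicalSpace M'] [ChartedSpace E' M']

/-- A complex derivative is a real derivative; `𝓘(ℂ, E)` and `𝓘(ℝ, E)` have the same charts. -/
theorem HasMFDerivAt.restrictScalars_real {f : M → M'} {p : M} {L : E →L[ℂ] E'}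
    (h : HasMFDerivAt 𝓘(ℂ, E) 𝓘(ℂ, E') f p L) :
    HasMFDerivAt 𝓘(ℝ, E) 𝓘(ℝ, E') f p (L.restrictScalars ℝ) :=
  ⟨h.1, HasFDerivWithinAt.restrictScalars ℝ h.2⟩

/-- The complex derivative of a map of manifolds, in the preferred charts. -/
noncomputable def complexDeriv (f : M → M') (p : M) : E →L[ℂ] E' :=
  mfderiv 𝓘(ℂ, E) 𝓘(ℂ, E') f p

/-- The real derivative of a map of manifolds, in the preferred charts. -/
noncomputable def realDeriv (f : M → M') (p : M) : E →L[ℝ] E' :=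
  mfderiv 𝓘(ℝ, E) 𝓘(ℝ, E') f p

theorem MDifferentiableAt.hasMFDerivAt_real {f : M → M'} {p : M}
    (h : MDifferentiableAt 𝓘(ℂ, E) 𝓘(ℂ, E') f p) :
    HasMFDerivAt 𝓘(ℝ, E) 𝓘(ℝ, E') f p ((complexDeriv (E := E) (E' := E') f p).restrictScalars ℝ) :=
  HasMFDerivAt.restrictScalars_real (L := complexDeriv f p) h.hasMFDerivAt

theorem MDifferentiableAt.realDeriv_eq {f : M → M'} {p : M}
    (h : MDifferentiableAt 𝓘(ℂ, E) 𝓘(ℂ, E') f p) :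
    realDeriv (E := E) (E' := E') f p = (complexDeriv f p).restrictScalars ℝ :=
  h.hasMFDerivAt_real.mfderiv

theorem MDifferentiableAt.real {f : M → M'} {p : M}
    (h : MDifferentiableAt 𝓘(ℂ, E) 𝓘(ℂ, E') f p) : MDifferentiableAt 𝓘(ℝ, E) 𝓘(ℝ, E') f p :=
  h.hasMFDerivAt_real.mdifferentiableAt

/-- The derivative at `x` of the inverse of the preferred chart at `q`. -/
noncomputable def chartSymmDeriv (q : M) (x : E) : E →L[ℝ] E :=
  realDeriv (extChartAt 𝓘(ℝ, E) q).symm x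

variable [IsManifold 𝓘(ℂ, E) ω M] [IsManifold 𝓘(ℂ, E') ω M']

theorem mdifferentiableAt_chart_symm {q : M} {x : E} (hx : x ∈ (extChartAt 𝓘(ℝ, E) q).target) :
    MDifferentiableAt 𝓘(ℂ, E) 𝓘(ℂ, E) (extChartAt 𝓘(ℝ, E) q).symm x :=
  ((contMDiffOn_extChartAt_symm (I := 𝓘(ℂ, E)) (n := ω) q).contMDiffAt
    ((isOpen_extChartAt_target (I := 𝓘(ℝ, E)) q).mem_nhds hx)).mdifferentiableAt (by simp)

theorem chartSymmDeriv_I {q : M} {x : E} (hx : x ∈ (extChartAt 𝓘(ℝ, E) q).target) (u : E) :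
    chartSymmDeriv q x (Complex.I • u) = Complex.I • chartSymmDeriv q x u := by
  rw [chartSymmDeriv, (mdifferentiableAt_chart_symm hx).realDeriv_eq]
  exact (complexDeriv (E := E) (E' := E) (extChartAt 𝓘(ℝ, E) q).symm x).map_smul Complex.I u

theorem chartSymmDeriv_injective {q : M} {x : E} (hx : x ∈ (extChartAt 𝓘(ℝ, E) q).target) :
    Function.Injective (chartSymmDeriv q x) := by
  have : IsManifold 𝓘(ℝ, E) 1 M := IsManifold.of_le (n := ω) le_top
  have h := isInvertible_mfderivWithin_extChartAt_symm (I := 𝓘(ℝ, E)) hx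
  rw [ModelWithCorners.range_eq_univ, mfderivWithin_univ] at h
  exact h.injective

theorem chartSymmDeriv_center (q : M) :
    chartSymmDeriv q (extChartAt 𝓘(ℝ, E) q q) = ContinuousLinearMap.id ℝ E := by
  have : IsManifold 𝓘(ℝ, E) 1 M := IsManifold.of_le (n := ω) le_top
  have h := mfderivWithin_range_extChartAt_symm (I := 𝓘(ℝ, E)) (x := q)
  rw [ModelWithCorners.range_eq_univ, mfderivWithin_univ] at h
  exact h

namespace KahlerMetric

/-- The metric at `p` as a bilinear form on the model space. -/
noncomputable def innerCLM (g : KahlerMetric E M) (p : M) : E →L[ℝ] E →L[ℝ] ℝ := g.inner p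

/-- The coordinate expression of the metric in the preferred chart at `q`. -/
noncomputable abbrev inChart (g : KahlerMetric E M) (q : M) : E → E →L[ℝ] E →L[ℝ] ℝ :=
  chartMetric g.toContMDiffRiemannianMetric q

variable (g : KahlerMetric E M)

theorem inChart_apply (q : M) (x u v : E) :
    g.inChart q x u v = g.innerCLM ((extChartAt 𝓘(ℝ, E) q).symm x) (chartSymmDeriv q x u)
      (chartSymmDeriv q x v) := rfl

theorem inChart_center (q : M) :
    g.inChart q (extChartAt 𝓘(ℝ, E) q q) = g.innerCLM q := by
  ext u v
  rw [inChart_apply, chartSymmDeriv_center, extChartAt_to_inv]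
  rfl

theorem innerCLM_symm (p : M) (u v : E) : g.innerCLM p u v = g.innerCLM p v u := g.symm p u v

theorem innerCLM_pos (p : M) (v : E) (hv : v ≠ 0) : 0 < g.innerCLM p v v := g.pos p v hv

theorem innerCLM_I (p : M) (u v : E) :
    g.innerCLM p (Complex.I • u) (Complex.I • v) = g.innerCLM p u v :=
  g.inner_cplxJ p u v

/-- The coefficients of the metric in a chart are smooth: the constant vector field `u` corresponds
to the smooth vector field `chartSymmDeriv q · u` along the inverse of the chart. -/
theorem contDiffOn_inChart_apply (q : M) (u v : E) :
    ContDiffOn ℝ ∞ (fun x => g.inChart q x u v) (extChartAt 𝓘(ℝ, E) q).target := by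
  have hM : IsManifold 𝓘(ℝ, E) 1 M := IsManifold.of_le (n := ω) le_top
  have ho := isOpen_extChartAt_target (I := 𝓘(ℝ, E)) q
  have hsymm : ContMDiffOn 𝓘(ℝ, E) 𝓘(ℝ, E) ω (extChartAt 𝓘(ℝ, E) q).symm
    (extChartAt 𝓘(ℝ, E) q).target := contMDiffOn_extChartAt_symm q
  have hvec : ∀ u : E, ContMDiffOn 𝓘(ℝ, E) 𝓘(ℝ, E).tangent ∞
      (fun x => (⟨(extChartAt 𝓘(ℝ, E) q).symm x, chartSymmDeriv q x u⟩ : TangentBundle 𝓘(ℝ, E) M))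
      (extChartAt 𝓘(ℝ, E) q).target := by
    intro u
    have h1 := hsymm.contMDiffOn_tangentMapWithin (m := ∞) le_top ho.uniqueMDiffOn
    have h2 : ContMDiffOn 𝓘(ℝ, E) 𝓘(ℝ, E).tangent ∞
        (fun x => (⟨x, u⟩ : TangentBundle 𝓘(ℝ, E) E)) (extChartAt 𝓘(ℝ, E) q).target :=
      contMDiffOn_vectorSpace_iff_contDiffOn.2 contDiffOn_const
    refine (h1.comp h2 fun x hx => hx).congr fun x hx => ?_
    simp only [Function.comp_apply, tangentMapWithin]
    rw [mfderivWithin_of_isOpen ho hx]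
    rfl
  have h3 : ContMDiffOn 𝓘(ℝ, E) (𝓘(ℝ, E).prod 𝓘(ℝ)) ∞
      (fun x => Bundle.TotalSpace.mk' ℝ (E := Bundle.Trivial M ℝ)
        ((extChartAt 𝓘(ℝ, E) q).symm x) (g.inChart q x u v)) (extChartAt 𝓘(ℝ, E) q).target := by
    exact ContMDiffOn.clm_bundle_apply₂ (F₁ := E) (F₂ := E) (F₃ := ℝ)
      (E₁ := fun p : M => TangentSpace 𝓘(ℝ, E) p) (E₂ := fun p : M => TangentSpace 𝓘(ℝ, E) p)
      (E₃ := Bundle.Trivial M ℝ) (b := (extChartAt 𝓘(ℝ, E) q).symm)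
      (ψ := fun x => g.inner ((extChartAt 𝓘(ℝ, E) q).symm x))
      (g.contMDiff.comp_contMDiffOn (hsymm.of_le le_top)) (hvec u) (hvec v)
  intro x hx
  have h4 := h3 x hx
  rw [Bundle.contMDiffWithinAt_totalSpace] at h4
  exact contMDiffWithinAt_iff_contDiffWithinAt.1 h4.2

theorem inChart_symm (q : M) (x u v : E) : g.inChart q x u v = g.inChart q x v u :=
  g.innerCLM_symm _ _ _

theorem inChart_pos {q : M} {x : E} (hx : x ∈ (extChartAt 𝓘(ℝ, E) q).target) (v : E)
    (hv : v ≠ 0) : 0 < g.inChart q x v v :=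
  g.innerCLM_pos _ _ fun h0 => hv (chartSymmDeriv_injective hx (by rw [map_zero]; exact h0))

theorem inChart_I {q : M} {x : E} (hx : x ∈ (extChartAt 𝓘(ℝ, E) q).target) (u v : E) :
    g.inChart q x (Complex.I • u) (Complex.I • v) = g.inChart q x u v := by
  rw [inChart_apply, chartSymmDeriv_I hx, chartSymmDeriv_I hx, g.innerCLM_I]
  rfl

theorem inChart_closed {q : M} {x : E} (hx : x ∈ (extChartAt 𝓘(ℝ, E) q).target) (u v w : E) :
    fderiv ℝ (g.inChart q) x u (Complex.I • v) w
    + fderiv ℝ (g.inChart q) x v (Complex.I • w) u + fderiv ℝ (g.inChart q) x w (Complex.I • u) v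
      = 0 := by
  exact g.closed q x hx u v w

variable [FiniteDimensional ℂ E]

theorem contDiffOn_inChart (q : M) :
    ContDiffOn ℝ ∞ (g.inChart q) (extChartAt 𝓘(ℝ, E) q).target := by
  rw [contDiffOn_clm_apply]
  intro u
  rw [contDiffOn_clm_apply]
  exact g.contDiffOn_inChart_apply q u

theorem isKahlerOn_inChart (q : M) :
    IsKahlerOn (g.inChart q) (extChartAt 𝓘(ℝ, E) q).target where
  isOpen := isOpen_extChartAt_target (I := 𝓘(ℝ, E)) q
  contDiffOn := g.contDiffOn_inChart q
  symm x _ u v := g.inChart_symm q x u v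
  pos _ hx v hv := g.inChart_pos hx v hv
  inner_I _ hx u v := g.inChart_I hx u v
  closed _ hx u v w := g.inChart_closed hx u v w

end KahlerMetric

end ChartExpression

/-! ### Comparison of curvatures under a holomorphic isometry -/

section Comparison

set_option maxSynthPendingDepth 3

variable {E : Type*} [NormedAddCommGroup E] [NormedSpace ℂ E]
  {M : Type*} [TopologicalSpace M] [ChartedSpace E M] [IsManifold 𝓘(ℂ, E) ω M]
  {E' : Type*} [NormedAddCommGroup E'] [NormedSpace ℂ E']
  {M' : Type*} [TopologicalSpace M'] [ChartedSpace E' M'] [IsManifold 𝓘(ℂ, E') ω M']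

theorem IsHolomorphicIsometry.id (g : KahlerMetric E M) : IsHolomorphicIsometry g g id where
  holomorphic := contMDiff_id
  isometric q u v := by
    rw [mfderiv_id]
    rfl

namespace IsHolomorphicIsometry

variable {g : KahlerMetric E M} {g' : KahlerMetric E' M'} {φ : M → M'}
  (hφ : IsHolomorphicIsometry g g' φ) (q : M) (p₀ : M')
include hφ

theorem innerCLM_realDeriv (p : M) (u v : E) :
    g'.innerCLM (φ p) (realDeriv (E := E) (E' := E') φ p u) (realDeriv (E := E) (E' := E') φ p v) =
      g.innerCLM p u v :=
  hφ.isometric p u v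

variable {q p₀} (hp : φ q ∈ (chartAt E' p₀).source)
include hp

theorem contMDiffAt_inCharts : ContMDiffAt 𝓘(ℂ, E) 𝓘(ℂ, E') ω
    (extChartAt 𝓘(ℝ, E') p₀ ∘ φ ∘ (extChartAt 𝓘(ℝ, E) q).symm) (extChartAt 𝓘(ℝ, E) q q) := by
  have e : (extChartAt 𝓘(ℝ, E) q).symm (extChartAt 𝓘(ℝ, E) q q) = q := extChartAt_to_inv q
  have h1 : ContMDiffAt 𝓘(ℂ, E) 𝓘(ℂ, E) ω (extChartAt 𝓘(ℝ, E) q).symm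
      (extChartAt 𝓘(ℝ, E) q q) :=
    (contMDiffOn_extChartAt_symm (I := 𝓘(ℂ, E)) (n := ω) q).contMDiffAt
      ((isOpen_extChartAt_target (I := 𝓘(ℝ, E)) q).mem_nhds (mem_extChartAt_target q))
  have h2 : ContMDiffAt 𝓘(ℂ, E') 𝓘(ℂ, E') ω (extChartAt 𝓘(ℝ, E') p₀) (φ q) :=
    contMDiffAt_extChartAt' (I := 𝓘(ℂ, E')) hp
  have h3 : ContMDiffAt 𝓘(ℂ, E) 𝓘(ℂ, E') ω φ q := hφ.holomorphic q
  rw [← e] at h2 h3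
  exact ContMDiffAt.comp _ h2 (ContMDiffAt.comp _ h3 h1)

theorem analyticAt_inCharts [CompleteSpace E'] : AnalyticAt ℂ
    (extChartAt 𝓘(ℝ, E') p₀ ∘ φ ∘ (extChartAt 𝓘(ℝ, E) q).symm) (extChartAt 𝓘(ℝ, E) q q) :=
  (hφ.contMDiffAt_inCharts hp).contDiffAt.analyticAt

/-- In charts, the metric of the source is the pull-back of the metric of the target. -/
theorem inChart_eq_pullback [CompleteSpace E'] :
    ∀ᶠ y in nhds (extChartAt 𝓘(ℝ, E) q q), ∀ u v : E,
      g.inChart q y u v = g'.inChart p₀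
        ((extChartAt 𝓘(ℝ, E') p₀ ∘ φ ∘ (extChartAt 𝓘(ℝ, E) q).symm) y)
        (fderiv ℂ (extChartAt 𝓘(ℝ, E') p₀ ∘ φ ∘ (extChartAt 𝓘(ℝ, E) q).symm) y u)
        (fderiv ℂ (extChartAt 𝓘(ℝ, E') p₀ ∘ φ ∘ (extChartAt 𝓘(ℝ, E) q).symm) y v) := by
  set χ := extChartAt 𝓘(ℝ, E) q
  set χ' := extChartAt 𝓘(ℝ, E') p₀
  set F : E → E' := χ' ∘ φ ∘ χ.symm with hF
  have hU : ∀ᶠ y in nhds (χ q), y ∈ χ.target :=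
    (isOpen_extChartAt_target (I := 𝓘(ℝ, E)) q).mem_nhds (mem_extChartAt_target q)
  have hs : IsOpen χ'.source := isOpen_extChartAt_source (I := 𝓘(ℝ, E')) p₀
  have hcont : ∀ y ∈ χ.target, ContinuousAt (φ ∘ χ.symm) y := fun y hy =>
    ContinuousAt.comp hφ.holomorphic.continuous.continuousAt
      (mdifferentiableAt_chart_symm hy).continuousAt
  have hV : ∀ᶠ y in nhds (χ q), φ (χ.symm y) ∈ χ'.source := by
    refine (hcont _ (mem_extChartAt_target q)).preimage_mem_nhds (hs.mem_nhds ?_)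
    rw [Function.comp_apply, extChartAt_to_inv]
    rwa [extChartAt_source]
  filter_upwards [hU, hV, (hφ.analyticAt_inCharts hp).eventually_analyticAt] with y hy hy' hFy u v
  have hpt : χ'.symm (F y) = φ (χ.symm y) := χ'.left_inv hy'
  have hFt : F y ∈ χ'.target := χ'.map_source hy'
  have hev : (χ'.symm ∘ F) =ᶠ[nhds y] φ ∘ χ.symm := by
    filter_upwards [(hcont y hy).preimage_mem_nhds (hs.mem_nhds hy')] with z hz
    exact χ'.left_inv hz
  let D₁ : E →L[ℝ] E' := (chartSymmDeriv p₀ (F y)) ∘L ((fderiv ℂ F y).restrictScalars ℝ)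
  let D₂ : E →L[ℝ] E' := (realDeriv (E := E) (E' := E') φ (χ.symm y)) ∘L (chartSymmDeriv q y)
  have d1 : HasMFDerivAt 𝓘(ℝ, E) 𝓘(ℝ, E') (χ'.symm ∘ F) y D₁ :=
    HasMFDerivAt.comp y (mdifferentiableAt_chart_symm hFt).real.hasMFDerivAt
      (hFy.differentiableAt.hasFDerivAt.restrictScalars ℝ).hasMFDerivAt
  have hφd : MDifferentiableAt 𝓘(ℂ, E) 𝓘(ℂ, E') φ (χ.symm y) :=
    (hφ.holomorphic _).mdifferentiableAt (by simp)
  have d2 : HasMFDerivAt 𝓘(ℝ, E) 𝓘(ℝ, E') (φ ∘ χ.symm) y D₂ :=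
    HasMFDerivAt.comp y hφd.real.hasMFDerivAt (mdifferentiableAt_chart_symm hy).real.hasMFDerivAt
  have d3 : D₁ = D₂ := hasMFDerivAt_unique d1 (d2.congr_of_eventuallyEq hev)
  have d4 : ∀ w : E, chartSymmDeriv p₀ (F y) (fderiv ℂ F y w) =
      realDeriv (E := E) (E' := E') φ (χ.symm y) (chartSymmDeriv q y w) := fun w =>
    congrArg (fun L : E →L[ℝ] E' => L w) d3
  rw [g.inChart_apply, g'.inChart_apply, d4, d4, hpt, hφ.innerCLM_realDeriv]

end IsHolomorphicIsometry

namespace KahlerMetric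

/-- The curvature tensor at `p` as a tensor on the model space. -/
noncomputable def riemannE (g : KahlerMetric E M) (p : M) (u v w z : E) : ℝ := g.riemann p u v w z

theorem riemannE_eq (g : KahlerMetric E M) (p : M) (u v w z : E) : g.riemannE p u v w z =
    g.inChart p (extChartAt 𝓘(ℝ, E) p p)
      (curvatureEndo (g.inChart p) (extChartAt 𝓘(ℝ, E) p p) u v z) w := by
  rw [g.inChart_center]
  rfl

variable [FiniteDimensional ℂ E] [FiniteDimensional ℂ E']

theorem isKahlerCurvature (g : KahlerMetric E M) (p : M) : IsKahlerCurvature (g.riemannE p) := by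
  have h := (g.isKahlerOn_inChart p).isKahlerCurvature (mem_extChartAt_target p)
  convert h using 1
  funext u v w z
  exact g.riemannE_eq p u v w z

/-- The Gauss inequality, with the target metric expressed in the chart at any `p₀` whose domain
contains the image point. -/
theorem exists_bisectional_le_inChart {g : KahlerMetric E M} {g' : KahlerMetric E' M'} {φ : M → M'}
    (hφ : IsHolomorphicIsometry g g' φ) {q : M} {p₀ : M'} (hp : φ q ∈ (chartAt E' p₀).source) :
    ∃ L : E →L[ℂ] E', (∀ u v, g'.inChart p₀ (extChartAt 𝓘(ℝ, E') p₀ (φ q)) (L u) (L v) =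
        g.innerCLM q u v) ∧
      ∀ a c, g.riemannE q a (Complex.I • a) c (Complex.I • c) ≤
        g'.inChart p₀ (extChartAt 𝓘(ℝ, E') p₀ (φ q))
          (curvatureEndo (g'.inChart p₀) (extChartAt 𝓘(ℝ, E') p₀ (φ q)) (L a) (Complex.I • L a)
            (Complex.I • L c)) (L c) := by
  have := FiniteDimensional.complete ℂ E'
  have hp' : φ q ∈ (extChartAt 𝓘(ℝ, E') p₀).source := by rwa [extChartAt_source]
  have hFx : (extChartAt 𝓘(ℝ, E') p₀ ∘ φ ∘ (extChartAt 𝓘(ℝ, E) q).symm)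
      (extChartAt 𝓘(ℝ, E) q q) = extChartAt 𝓘(ℝ, E') p₀ (φ q) := by
    simp only [Function.comp_apply, extChartAt_to_inv]
  have hpull := hφ.inChart_eq_pullback hp
  refine ⟨fderiv ℂ (extChartAt 𝓘(ℝ, E') p₀ ∘ φ ∘ (extChartAt 𝓘(ℝ, E) q).symm)
    (extChartAt 𝓘(ℝ, E) q q), fun u v => ?_, fun a c => ?_⟩
  · have := hpull.self_of_nhds u v
    rw [g.inChart_center, hFx] at this
    exact this.symm
  · have := (g.isKahlerOn_inChart q).bisectional_le_of_isometry (g'.isKahlerOn_inChart p₀)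
      (mem_extChartAt_target q) (hφ.analyticAt_inCharts hp)
      (by rw [hFx]; exact (extChartAt 𝓘(ℝ, E') p₀).map_source hp') hpull a c
    rw [hFx] at this
    rwa [g.riemannE_eq]

/-- The Gauss inequality for a holomorphic isometry. -/
theorem exists_bisectional_le {g : KahlerMetric E M} {g' : KahlerMetric E' M'} {φ : M → M'}
    (hφ : IsHolomorphicIsometry g g' φ) (q : M) :
    ∃ L : E →L[ℂ] E', (∀ u v, g'.innerCLM (φ q) (L u) (L v) = g.innerCLM q u v) ∧
      ∀ a c, g.riemannE q a (Complex.I • a) c (Complex.I • c) ≤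
        g'.riemannE (φ q) (L a) (Complex.I • L a) (L c) (Complex.I • L c) := by
  obtain ⟨L, h1, h2⟩ := exists_bisectional_le_inChart hφ (q := q) (mem_chart_source E' (φ q))
  refine ⟨L, fun u v => ?_, fun a c => ?_⟩
  · rw [← h1, g'.inChart_center]
  · rw [g'.riemannE_eq]
    exact h2 a c

end KahlerMetric

end Comparison

/-! ### The quotient defining the bisectional curvature -/

section Complexified

variable {V : Type*} [AddCommGroup V] [Module ℂ V]

/-- `R(X, X̄, Ȳ, Y) = 4 R(a, Ja, c, Jc)` for `X = a - iJa` and `Y = c - iJc`. -/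
theorem IsKahlerCurvature.cExt4_eq {T : V → V → V → V → ℝ} (h : IsKahlerCurvature T) (a c : V) :
    cExt4 T (a, -(Complex.I • a)) (cConj (a, -(Complex.I • a))) (cConj (c, -(Complex.I • c)))
      (c, -(Complex.I • c)) = ((4 * T a (Complex.I • a) c (Complex.I • c) : ℝ) : ℂ) := by
  simp only [cExt4, cExt, cConj, neg_neg, h.neg_left, h.neg_four, h.self_left,
    h.antisymm_left a (Complex.I • a), h.antisymm_right _ _ c (Complex.I • c), h.pair_symm _ _ c c,
    h.pair_symm _ _ (Complex.I • c) (Complex.I • c)]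
  push_cast
  linear_combination (-4 * (T a (Complex.I • a) c (Complex.I • c) : ℂ)) * Complex.I_sq

end Complexified

section Bisectional

set_option maxSynthPendingDepth 3

variable {E : Type*} [NormedAddCommGroup E] [NormedSpace ℂ E]
  {M : Type*} [TopologicalSpace M] [ChartedSpace E M] [IsManifold 𝓘(ℂ, E) ω M]

namespace KahlerMetric

variable (g : KahlerMetric E M) (q : M)

/-- The expression `|a|² |c|² + g(a, c)² + g(a, Jc)²`: one quarter of the denominator of the
bisectional curvature of `a - iJa` and `c - iJc`. -/
noncomputable def bisectionalDenom (a c : E) : ℝ :=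
  g.innerCLM q a a * g.innerCLM q c c + g.innerCLM q a c ^ 2 + g.innerCLM q a (Complex.I • c) ^ 2

theorem innerCLM_I_left (u v : E) :
    g.innerCLM q (Complex.I • u) v = - g.innerCLM q u (Complex.I • v) := by
  have := g.innerCLM_I q u (Complex.I • v)
  rw [smul_smul, Complex.I_mul_I, neg_one_smul, map_neg] at this
  linarith

theorem innerCLM_self_nonneg (v : E) : 0 ≤ g.innerCLM q v v := by
  rcases eq_or_ne v 0 with rfl | hv
  · simp
  · exact (g.innerCLM_pos q v hv).le

theorem mul_le_bisectionalDenom (a c : E) :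
    g.innerCLM q a a * g.innerCLM q c c ≤ g.bisectionalDenom q a c := by
  unfold bisectionalDenom
  nlinarith [sq_nonneg (g.innerCLM q a c), sq_nonneg (g.innerCLM q a (Complex.I • c))]

theorem bisectionalDenom_pos {a c : E} (ha : a ≠ 0) (hc : c ≠ 0) :
    0 < g.bisectionalDenom q a c :=
  (mul_pos (g.innerCLM_pos q a ha) (g.innerCLM_pos q c hc)).trans_le
    (g.mul_le_bisectionalDenom q a c)

theorem cExt2_eq (a c : E) :
    cExt2 (fun u v => g.innerCLM q u v) (a, -(Complex.I • a)) (cConj (c, -(Complex.I • c))) =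
      ((2 * g.innerCLM q a c : ℝ) : ℂ)
        + ((2 * g.innerCLM q a (Complex.I • c) : ℝ) : ℂ) * Complex.I := by
  simp only [cExt2, cExt, cConj, neg_neg, map_neg, neg_apply, g.innerCLM_I,
    g.innerCLM_I_left]
  push_cast
  linear_combination (-(g.innerCLM q a c : ℂ)) * Complex.I_sq

omit [IsManifold 𝓘(ℂ, E) ω M] in
/-- Vectors of type `(1, 0)` are those of the form `a - iJa`. -/
theorem eq_of_mem_holTangent {X : RealTangent E q × RealTangent E q} (hX : X ∈ holTangent E q) :
    X = ((show E from X.1), -(Complex.I • (show E from X.1))) := by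
  refine Prod.ext rfl ?_
  have h1 := hX.1
  have h2 : X.2 = - cplxJ q X.1 := by rw [h1, neg_neg]
  exact h2

omit [IsManifold 𝓘(ℂ, E) ω M] in
theorem mem_holTangent (a : E) :
    ((a, -(Complex.I • a)) : RealTangent E q × RealTangent E q) ∈ holTangent E q := by
  refine ⟨?_, ?_⟩
  · exact (neg_neg (Complex.I • a)).symm
  · have : Complex.I • (-(Complex.I • a)) = a := by
      rw [smul_neg, smul_smul, Complex.I_mul_I, neg_one_smul, neg_neg]
    exact this

variable [FiniteDimensional ℂ E]

theorem bisectional_mk (a c : E) :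
    g.bisectional q (a, -(Complex.I • a)) (c, -(Complex.I • c)) =
      g.riemannE q a (Complex.I • a) c (Complex.I • c) / g.bisectionalDenom q a c := by
  have h4 := (g.isKahlerCurvature q).cExt4_eq a c
  have hinner : ∀ a c : E, g.hermInner q (a, -(Complex.I • a)) (c, -(Complex.I • c)) =
      ((2 * g.innerCLM q a c : ℝ) : ℂ)
        + ((2 * g.innerCLM q a (Complex.I • c) : ℝ) : ℂ) * Complex.I :=
    fun a c => g.cExt2_eq q a c
  have hnorm : ∀ a : E, g.hermNormSq q (a, -(Complex.I • a)) = 2 * g.innerCLM q a a := by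
    intro a
    rw [hermNormSq, hinner]
    simp
  have hnum : (cExt4 (g.riemann q) (a, -(Complex.I • a)) (cConj (a, -(Complex.I • a)))
      (cConj (c, -(Complex.I • c))) (c, -(Complex.I • c))).re =
      4 * g.riemannE q a (Complex.I • a) c (Complex.I • c) := by
    have := congrArg Complex.re h4
    rwa [Complex.ofReal_re] at this
  have hden : g.hermNormSq q (a, -(Complex.I • a)) * g.hermNormSq q (c, -(Complex.I • c)) +
      ‖g.hermInner q (a, -(Complex.I • a)) (c, -(Complex.I • c))‖ ^ 2 =
      4 * g.bisectionalDenom q a c := by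
    rw [hnorm, hnorm, hinner, Complex.sq_norm, Complex.normSq_add_mul_I, bisectionalDenom]
    ring
  unfold bisectional
  rw [hnum, hden, mul_div_mul_left _ _ four_ne_zero]

theorem bisectional_eq {X Y : RealTangent E q × RealTangent E q} (hX : X ∈ holTangent E q)
    (hY : Y ∈ holTangent E q) (hX0 : X ≠ 0) (hY0 : Y ≠ 0) :
    ∃ a c : E, a ≠ 0 ∧ c ≠ 0 ∧ g.bisectional q X Y =
      g.riemannE q a (Complex.I • a) c (Complex.I • c) / g.bisectionalDenom q a c := by
  refine ⟨X.1, Y.1, fun h => hX0 ?_, fun h => hY0 ?_, ?_⟩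
  · rw [eq_of_mem_holTangent q hX]
    refine Prod.ext h ?_
    change -(Complex.I • (show E from X.1)) = 0
    rw [show (show E from X.1) = 0 from h, smul_zero, neg_zero]
  · rw [eq_of_mem_holTangent q hY]
    refine Prod.ext h ?_
    change -(Complex.I • (show E from Y.1)) = 0
    rw [show (show E from Y.1) = 0 from h, smul_zero, neg_zero]
  · conv_lhs => rw [eq_of_mem_holTangent q hX, eq_of_mem_holTangent q hY]
    exact g.bisectional_mk q X.1 Y.1

theorem mem_bisectionalValues {a c : E} (ha : a ≠ 0) (hc : c ≠ 0) :
    g.riemannE q a (Complex.I • a) c (Complex.I • c) / g.bisectionalDenom q a c ∈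
      g.bisectionalValues q :=
  ⟨_, mem_holTangent q a, _, mem_holTangent q c, fun h => ha (congrArg Prod.fst h),
    fun h => hc (congrArg Prod.fst h), (g.bisectional_mk q a c).symm⟩

theorem riemannE_zero_left (c : E) :
    g.riemannE q 0 (Complex.I • (0 : E)) c (Complex.I • c) = 0 := by
  rw [smul_zero, (g.isKahlerCurvature q).self_left]

theorem riemannE_zero_right (a : E) :
    g.riemannE q a (Complex.I • a) 0 (Complex.I • (0 : E)) = 0 := by
  rw [(g.isKahlerCurvature q).bisectional_symm, g.riemannE_zero_left]

theorem riemannE_le_of_bddAbove (hb : BddAbove (g.bisectionalValues q)) (a c : E) :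
    g.riemannE q a (Complex.I • a) c (Complex.I • c) ≤
      g.bisectionalSup q * g.bisectionalDenom q a c := by
  rcases eq_or_ne a 0 with rfl | ha
  · rw [g.riemannE_zero_left]
    simp [bisectionalDenom]
  rcases eq_or_ne c 0 with rfl | hc
  · rw [g.riemannE_zero_right]
    simp [bisectionalDenom]
  rw [← div_le_iff₀ (g.bisectionalDenom_pos q ha hc)]
  exact le_csSup hb (g.mem_bisectionalValues q ha hc)

/-- A bound by the product of the square norms bounds the values of the bisectional curvature. -/
theorem mem_upperBounds_of_le {C : ℝ} (hC : 0 ≤ C)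
    (h : ∀ a c, g.riemannE q a (Complex.I • a) c (Complex.I • c) ≤
      C * (g.innerCLM q a a * g.innerCLM q c c)) : C ∈ upperBounds (g.bisectionalValues q) := by
  rintro r ⟨X, hX, Y, hY, hX0, hY0, rfl⟩
  obtain ⟨a, c, ha, hc, e⟩ := g.bisectional_eq q hX hY hX0 hY0
  rw [e, div_le_iff₀ (g.bisectionalDenom_pos q ha hc)]
  exact (h a c).trans (mul_le_mul_of_nonneg_left (g.mul_le_bisectionalDenom q a c) hC)

/-! ### Ricci and scalar curvature in a unitary frame -/

/-- The metric at `q` as a bilinear map. -/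
noncomputable def innerBilin : E →ₗ[ℝ] E →ₗ[ℝ] ℝ :=
  LinearMap.mk₂ ℝ (fun u v => g.innerCLM q u v) (by simp) (by simp) (by simp) (by simp)

/-- The tangent space at `q` has a unitary frame, given here as an isomorphism with the standard
Hermitian space. -/
theorem exists_unitaryFrame : ∃ Φ : EuclideanSpace ℂ (Fin (Module.finrank ℂ E)) ≃ₗ[ℂ] E,
    ∀ u v, g.innerBilin q (Φ u) (Φ v) = (inner ℂ u v).re :=
  exists_linearEquiv_of_inner (g.innerBilin q) (g.innerCLM_symm q) (g.innerCLM_pos q)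
    (g.innerCLM_I q)

variable {g q}
variable {H : Type*} [NormedAddCommGroup H] [InnerProductSpace ℂ H] {Φ : H ≃ₗ[ℂ] E}
  (hΦ : ∀ u v, g.innerBilin q (Φ u) (Φ v) = (inner ℂ u v).re)
include hΦ

omit [FiniteDimensional ℂ E] in
theorem innerCLM_frame (u : H) : g.innerCLM q (Φ u) (Φ u) = ‖u‖ ^ 2 := by
  refine (hΦ u u).trans ?_
  rw [inner_self_eq_norm_sq_to_K]
  norm_cast

omit [FiniteDimensional ℂ E] in
theorem bisectionalDenom_frame (u v : H) :
    g.bisectionalDenom q (Φ u) (Φ v) = ‖u‖ ^ 2 * ‖v‖ ^ 2 + ‖inner ℂ u v‖ ^ 2 := by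
  have h1 : g.innerCLM q (Φ u) (Φ v) = (inner ℂ u v).re := hΦ u v
  have h2 : g.innerCLM q (Φ u) (Complex.I • Φ v) = - (inner ℂ u v).im := by
    rw [← map_smul]
    refine (hΦ u (Complex.I • v)).trans ?_
    rw [inner_smul_right]
    simp
  rw [bisectionalDenom, innerCLM_frame hΦ, innerCLM_frame hΦ, h1, h2, Complex.sq_norm,
    Complex.normSq_apply]
  ring

variable {ι : Type*} [Fintype ι] (b : OrthonormalBasis ι ℂ H)

theorem ricci_self_eq (v : E) :
    g.ricci q v v = ∑ i, g.riemannE q (Φ (b i)) (Complex.I • Φ (b i)) v (Complex.I • v) :=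
  (g.isKahlerCurvature q).ricci_self_eq_sum (g.innerBilin q) Φ hΦ b v

theorem scalarCurvature_eq :
    g.scalarCurvature q =
      2 * ∑ i, ∑ j, g.riemannE q (Φ (b i)) (Complex.I • Φ (b i)) (Φ (b j)) (Complex.I • Φ (b j)) :=
  (g.isKahlerCurvature q).scalar_eq_sum (g.innerBilin q) Φ hΦ b

omit hΦ

/-- A Kähler metric whose bisectional curvature is bounded above by `K` has bisectional curvature
bounded below in terms of `K` and the scalar curvature. -/
theorem le_riemannE {K : ℝ}
    (hK : ∀ a c, g.riemannE q a (Complex.I • a) c (Complex.I • c) ≤ K * g.bisectionalDenom q a c)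
    (a c : E) :
    (1 / 4 * g.scalarCurvature q
      - ((Module.finrank ℂ E : ℝ) ^ 2 + Module.finrank ℂ E - 2) / 2 * K) *
        g.bisectionalDenom q a c ≤ g.riemannE q a (Complex.I • a) c (Complex.I • c) := by
  obtain ⟨Φ, hΦ⟩ := g.exists_unitaryFrame q
  have hT := (g.isKahlerCurvature q).comp Φ.toLinearMap
  have key := hT.le_bisectional (K := K) (s := g.scalarCurvature q / 2)
    (n := Module.finrank ℂ E)
    (fun u v => by
      rw [← bisectionalDenom_frame hΦ]
      simpa only [LinearEquiv.coe_coe, map_smul] using hK (Φ u) (Φ v))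
    (fun b => by
      rw [scalarCurvature_eq hΦ b]
      simp only [LinearEquiv.coe_coe, map_smul]
      ring)
    (by simp) (Φ.symm a) (Φ.symm c)
  rw [← bisectionalDenom_frame hΦ] at key
  simp only [LinearEquiv.coe_coe, map_smul, LinearEquiv.apply_symm_apply] at key
  calc _ = _ := by ring
    _ ≤ _ := key

/-- A lower bound of the bisectional curvature gives one of the Ricci curvature. -/
theorem le_ricci {D : ℝ} (hD : 0 ≤ D)
    (h : ∀ a c, -D * g.bisectionalDenom q a c ≤ g.riemannE q a (Complex.I • a) c (Complex.I • c))
    (v : E) :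
    -2 * (Module.finrank ℂ E : ℝ) * D * g.innerCLM q v v ≤ g.ricci q v v := by
  obtain ⟨Φ, hΦ⟩ := g.exists_unitaryFrame q
  let b := EuclideanSpace.basisFun (Fin (Module.finrank ℂ E)) ℂ
  rw [ricci_self_eq hΦ b]
  have hterm : ∀ i, -2 * D * g.innerCLM q v v ≤
      g.riemannE q (Φ (b i)) (Complex.I • Φ (b i)) v (Complex.I • v) := by
    intro i
    refine le_trans ?_ (h _ _)
    obtain ⟨w, rfl⟩ := Φ.surjective v
    rw [innerCLM_frame hΦ, bisectionalDenom_frame hΦ, b.norm_eq_one]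
    have hcs : ‖inner ℂ (b i) w‖ ≤ ‖w‖ := by
      simpa [b.norm_eq_one] using norm_inner_le_norm (𝕜 := ℂ) (b i) w
    have hcs2 : ‖inner ℂ (b i) w‖ ^ 2 ≤ ‖w‖ ^ 2 := pow_le_pow_left₀ (norm_nonneg _) hcs 2
    nlinarith
  calc _ = ∑ _i : Fin (Module.finrank ℂ E), -2 * D * g.innerCLM q v v := by
        rw [Finset.sum_const, Finset.card_univ, Fintype.card_fin, nsmul_eq_mul]
        ring
    _ ≤ _ := Finset.sum_le_sum fun i _ => hterm i

end KahlerMetric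

end Bisectional

/-! ### Local bounds for the curvature -/

section LocalBound

set_option maxSynthPendingDepth 3

/-- Near a point the metric is bounded below by a multiple of the norm of the model space. -/
theorem IsKahlerOn.eventually_norm_sq_le {V : Type*} [NormedAddCommGroup V] [NormedSpace ℂ V]
    [FiniteDimensional ℂ V] {G : V → V →L[ℝ] V →L[ℝ] ℝ} {U : Set V} (h : IsKahlerOn G U) {x₀ : V}
    (hx₀ : x₀ ∈ U) : ∃ δ > 0, ∀ᶠ x in nhds x₀, ∀ a, δ * ‖a‖ ^ 2 ≤ G x a a := by
  have : ProperSpace V := FiniteDimensional.proper ℂ V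
  obtain ⟨δ, hδ, hmin⟩ : ∃ δ > 0, ∀ a : V, ‖a‖ = 1 → δ ≤ G x₀ a a := by
    rcases (Metric.sphere (0 : V) 1).eq_empty_or_nonempty with he | hne
    · refine ⟨1, one_pos, fun a ha => ?_⟩
      have : a ∈ Metric.sphere (0 : V) 1 := by simpa using ha
      rw [he] at this
      exact this.elim
    · obtain ⟨m, hm, hmin⟩ := (isCompact_sphere (0 : V) 1).exists_isMinOn hne
        (f := fun a => G x₀ a a) (by fun_prop)
      have hm1 : ‖m‖ = 1 := by simpa using hm
      refine ⟨G x₀ m m, h.pos x₀ hx₀ m fun h0 => by simp [h0] at hm1, fun a ha => ?_⟩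
      exact hmin (by simpa using ha)
  have hmin' : ∀ a : V, δ * ‖a‖ ^ 2 ≤ G x₀ a a := by
    intro a
    rcases eq_or_ne a 0 with rfl | ha
    · simp
    have ha0 : ‖a‖ ≠ 0 := norm_ne_zero_iff.2 ha
    have h1 := hmin (‖a‖⁻¹ • a) (by rw [norm_smul, norm_inv, norm_norm, inv_mul_cancel₀ ha0])
    rw [map_smul, map_smul, smul_apply, smul_eq_mul, smul_eq_mul] at h1
    have h2 := mul_le_mul_of_nonneg_right h1 (sq_nonneg ‖a‖)
    calc _ ≤ _ := h2
      _ = _ := by field_simp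
  refine ⟨δ / 2, half_pos hδ, ?_⟩
  have hc : ContinuousAt G x₀ := (h.hasFDerivAt hx₀).continuousAt
  filter_upwards [hc.eventually (Metric.ball_mem_nhds (G x₀) (half_pos hδ))] with x hx a
  have h1 : ‖(G x - G x₀) a a‖ ≤ δ / 2 * ‖a‖ * ‖a‖ := by
    refine ((G x - G x₀).le_opNorm₂ a a).trans ?_
    have : ‖G x - G x₀‖ ≤ δ / 2 := by
      rw [← dist_eq_norm]; exact (Metric.mem_ball.1 hx).le
    gcongr
  have h2 := (abs_le.1 h1).1
  rw [sub_apply, sub_apply] at h2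
  have := hmin' a
  nlinarith

/-- The bisectional curvature is locally bounded, in a fixed chart. -/
theorem IsKahlerOn.eventually_bisectional_le {V : Type*} [NormedAddCommGroup V] [NormedSpace ℂ V]
    [FiniteDimensional ℂ V] {G : V → V →L[ℝ] V →L[ℝ] ℝ} {U : Set V} (h : IsKahlerOn G U) {x₀ : V}
    (hx₀ : x₀ ∈ U) : ∃ C ≥ 0, ∀ᶠ x in nhds x₀, ∀ a c,
      G x (curvatureEndo G x a (Complex.I • a) (Complex.I • c)) c ≤ C * (G x a a * G x c c) := by
  obtain ⟨δ, hδ, hlow⟩ := h.eventually_norm_sq_le hx₀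
  set B : V → ℝ := fun x => ‖G x‖ * (2 * ‖fderiv ℝ (christoffelCLM G) x‖
    + 2 * ‖christoffelCLM G x‖ ^ 2) with hB
  have hΓ : ContinuousAt (christoffelCLM G) x₀ := (h.hasFDerivAt_christoffel hx₀).continuousAt
  have hG : ContinuousAt G x₀ := (h.hasFDerivAt hx₀).continuousAt
  have hDΓ : ContinuousAt (fderiv ℝ (christoffelCLM G)) x₀ :=
    (h.contDiffOn_christoffel.continuousOn_fderiv_of_isOpen h.isOpen (by simp)).continuousAt
      (h.isOpen.mem_nhds hx₀)
  have hBc : ContinuousAt B x₀ :=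
    hG.norm.mul ((hDΓ.norm.const_mul 2).add ((hΓ.norm.pow 2).const_mul 2))
  have hB0 : 0 ≤ B x₀ := by positivity
  refine ⟨(B x₀ + 1) / δ ^ 2, by positivity, ?_⟩
  filter_upwards [hlow, h.isOpen.mem_nhds hx₀, hBc.eventually (gt_mem_nhds (lt_add_one (B x₀)))]
    with x hx hxU hxB a c
  have hI : ∀ v : V, ‖Complex.I • v‖ = ‖v‖ := fun v => by rw [norm_smul, Complex.norm_I, one_mul]
  set Γ := christoffelCLM G x
  set DΓ := fderiv ℝ (christoffelCLM G) x
  have b1 : ∀ u v w : V, ‖DΓ u v w‖ ≤ ‖DΓ‖ * ‖u‖ * ‖v‖ * ‖w‖ := by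
    intro u v w
    refine ((DΓ u).le_opNorm₂ v w).trans ?_
    gcongr
    exact DΓ.le_opNorm u
  have b2 : ∀ u v w : V, ‖Γ u (Γ v w)‖ ≤ ‖Γ‖ * ‖u‖ * (‖Γ‖ * ‖v‖ * ‖w‖) := by
    intro u v w
    refine (Γ.le_opNorm₂ u _).trans ?_
    gcongr
    exact Γ.le_opNorm₂ v w
  have b3 : ‖curvatureEndo G x a (Complex.I • a) (Complex.I • c)‖ ≤
      (2 * ‖DΓ‖ + 2 * ‖Γ‖ ^ 2) * ‖a‖ ^ 2 * ‖c‖ := by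
    rw [h.curvatureEndo_eq hxU]
    have n1 := b1 a (Complex.I • a) (Complex.I • c)
    have n2 := b1 (Complex.I • a) a (Complex.I • c)
    have n3 := b2 a (Complex.I • a) (Complex.I • c)
    have n4 := b2 (Complex.I • a) a (Complex.I • c)
    simp only [hI] at n1 n2 n3 n4
    refine (norm_sub_le _ _).trans ((add_le_add (norm_add_le _ _) (norm_add_le _ _)).trans ?_)
    calc _ ≤ (‖DΓ‖ * ‖a‖ * ‖a‖ * ‖c‖ + ‖Γ‖ * ‖a‖ * (‖Γ‖ * ‖a‖ * ‖c‖)) +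
        (‖DΓ‖ * ‖a‖ * ‖a‖ * ‖c‖ + ‖Γ‖ * ‖a‖ * (‖Γ‖ * ‖a‖ * ‖c‖)) :=
          add_le_add (add_le_add n1 n3) (add_le_add n2 n4)
      _ = _ := by ring
  calc G x (curvatureEndo G x a (Complex.I • a) (Complex.I • c)) c
      ≤ ‖G x‖ * ‖curvatureEndo G x a (Complex.I • a) (Complex.I • c)‖ * ‖c‖ :=
        (le_abs_self _).trans ((G x).le_opNorm₂ _ _)
    _ ≤ ‖G x‖ * ((2 * ‖DΓ‖ + 2 * ‖Γ‖ ^ 2) * ‖a‖ ^ 2 * ‖c‖) * ‖c‖ := by gcongr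
    _ = B x * (‖a‖ ^ 2 * ‖c‖ ^ 2) := by rw [hB]; ring
    _ ≤ (B x₀ + 1) * (‖a‖ ^ 2 * ‖c‖ ^ 2) := by gcongr
    _ = (B x₀ + 1) / δ ^ 2 * ((δ * ‖a‖ ^ 2) * (δ * ‖c‖ ^ 2)) := by field_simp
    _ ≤ _ := by
        gcongr
        · exact h.inner_nonneg hxU a
        · exact hx a
        · exact hx c

variable {E : Type*} [NormedAddCommGroup E] [NormedSpace ℂ E] [FiniteDimensional ℂ E]
  {M : Type*} [TopologicalSpace M] [ChartedSpace E M] [IsManifold 𝓘(ℂ, E) ω M]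

namespace KahlerMetric

variable (g : KahlerMetric E M)

/-- The bisectional curvature is locally bounded.  As the curvature at a point is computed in the
preferred chart of that point, the Gauss inequality for the identity map serves to pass to one
chart. -/
theorem eventually_riemannE_le (p₀ : M) : ∃ C ≥ 0, ∀ᶠ p in nhds p₀, ∀ a c,
    g.riemannE p a (Complex.I • a) c (Complex.I • c) ≤
      C * (g.innerCLM p a a * g.innerCLM p c c) := by
  obtain ⟨C, hC, hev⟩ := (g.isKahlerOn_inChart p₀).eventually_bisectional_le
    (mem_extChartAt_target p₀)
  refine ⟨C, hC, ?_⟩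
  filter_upwards [(continuousAt_extChartAt (I := 𝓘(ℝ, E)) p₀).eventually hev,
    (chartAt E p₀).open_source.mem_nhds (mem_chart_source E p₀)] with p hp hps a c
  obtain ⟨L, h1, h2⟩ := exists_bisectional_le_inChart (IsHolomorphicIsometry.id g) (q := p)
    (p₀ := p₀) hps
  refine (h2 a c).trans ((hp (L a) (L c)).trans_eq ?_)
  rw [← h1, ← h1]
  rfl

theorem bddAbove_bisectionalValues (p : M) : BddAbove (g.bisectionalValues p) := by
  obtain ⟨C, hC, hev⟩ := g.eventually_riemannE_le p
  exact ⟨C, g.mem_upperBounds_of_le p hC hev.self_of_nhds⟩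

theorem exists_riemannE_le [CompactSpace M] : ∃ C ≥ 0, ∀ p a c,
    g.riemannE p a (Complex.I • a) c (Complex.I • c) ≤
      C * (g.innerCLM p a a * g.innerCLM p c c) := by
  choose C hC hev using g.eventually_riemannE_le
  obtain ⟨t, ht⟩ := CompactSpace.elim_nhds_subcover _ hev
  refine ⟨∑ p ∈ t, C p, Finset.sum_nonneg fun p _ => hC p, fun p a c => ?_⟩
  have hp : p ∈ ⋃ x ∈ t, {p | ∀ a c, g.riemannE p a (Complex.I • a) c (Complex.I • c) ≤
      C x * (g.innerCLM p a a * g.innerCLM p c c)} := ht.symm ▸ Set.mem_univ p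
  simp only [Set.mem_iUnion, Set.mem_ofPred_eq] at hp
  obtain ⟨x, hxt, hx⟩ := hp
  refine (hx a c).trans (mul_le_mul_of_nonneg_right
    (Finset.single_le_sum (fun p _ => hC p) hxt)
    (mul_nonneg (g.innerCLM_self_nonneg p a) (g.innerCLM_self_nonneg p c)))

end KahlerMetric

end LocalBound

/-! ### The curvature bounds -/

section Main

variable {E : Type*} [NormedAddCommGroup E] [NormedSpace ℂ E]
  {M : Type*} [TopologicalSpace M] [ChartedSpace E M] [IsManifold 𝓘(ℂ, E) ω M]
  {E' : Type*} [NormedAddCommGroup E'] [NormedSpace ℂ E']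
  {M' : Type*} [TopologicalSpace M'] [ChartedSpace E' M'] [IsManifold 𝓘(ℂ, E') ω M']

theorem KahlerMetric.bisectionalDenom_map {g : KahlerMetric E M} {g' : KahlerMetric E' M'} {q : M}
    {q' : M'} {L : E →L[ℂ] E'} (hL : ∀ u v, g'.innerCLM q' (L u) (L v) = g.innerCLM q u v)
    (a c : E) : g'.bisectionalDenom q' (L a) (L c) = g.bisectionalDenom q a c := by
  unfold KahlerMetric.bisectionalDenom
  rw [hL, hL, hL, ← map_smul, hL]

variable [FiniteDimensional ℂ E] [FiniteDimensional ℂ E']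

/-- Upper bounds of the bisectional curvature pass to the source of a holomorphic isometry. -/
theorem IsHolomorphicIsometry.riemannE_le {g : KahlerMetric E M} {g' : KahlerMetric E' M'}
    {φ : M → M'} (hφ : IsHolomorphicIsometry g g' φ) (q : M) {K : ℝ}
    (hK : ∀ a c, g'.riemannE (φ q) a (Complex.I • a) c (Complex.I • c) ≤
      K * g'.bisectionalDenom (φ q) a c) (a c : E) :
    g.riemannE q a (Complex.I • a) c (Complex.I • c) ≤ K * g.bisectionalDenom q a c := by
  obtain ⟨L, h1, h2⟩ := KahlerMetric.exists_bisectional_le hφ q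
  refine (h2 a c).trans ((hK _ _).trans_eq ?_)
  rw [KahlerMetric.bisectionalDenom_map h1]

end Main

theorem lemma4p1 {n N : ℕ}
    {Mhat : Type v} [TopologicalSpace Mhat] [ChartedSpace (EuclideanSpace ℂ (Fin N)) Mhat]
    [IsManifold 𝓘(ℂ, EuclideanSpace ℂ (Fin N)) ω Mhat]
    (ghat : KahlerMetric (EuclideanSpace ℂ (Fin N)) Mhat) :
    (∀ qhat : Mhat, BddAbove (ghat.bisectionalValues qhat)) ∧
    (∀ {M : Type u} [TopologicalSpace M] [ChartedSpace (EuclideanSpace ℂ (Fin n)) M]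
      [IsManifold 𝓘(ℂ, EuclideanSpace ℂ (Fin n)) ω M]
      (g : KahlerMetric (EuclideanSpace ℂ (Fin n)) M) (φ : M → Mhat),
      IsHolomorphicIsometry g ghat φ →
      ∀ q : M, ∀ X ∈ KahlerMetric.holTangent (EuclideanSpace ℂ (Fin n)) q,
        ∀ Y ∈ KahlerMetric.holTangent (EuclideanSpace ℂ (Fin n)) q, X ≠ 0 → Y ≠ 0 →
        1 / 4 * g.scalarCurvature q
            - ((n : ℝ) ^ 2 + n - 2) / 2 * ghat.bisectionalSup (φ q) ≤ g.bisectional q X Y ∧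
          g.bisectional q X Y ≤ ghat.bisectionalSup (φ q)) ∧
    (CompactSpace Mhat → ∀ R₀ : ℝ, ∃ K₁ : ℝ,
      ∀ {M : Type u} [TopologicalSpace M] [ChartedSpace (EuclideanSpace ℂ (Fin n)) M]
        [IsManifold 𝓘(ℂ, EuclideanSpace ℂ (Fin n)) ω M]
        (g : KahlerMetric (EuclideanSpace ℂ (Fin n)) M) (φ : M → Mhat),
        IsHolomorphicIsometry g ghat φ → (∀ q : M, R₀ ≤ g.scalarCurvature q) →
        ∀ (q : M) (v : RealTangent (EuclideanSpace ℂ (Fin n)) q),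
          -2 * (n : ℝ) * (n + 1) * K₁ * g.inner q v v ≤ g.ricci q v v) := by
  have hfin : Module.finrank ℂ (EuclideanSpace ℂ (Fin n)) = n := by simp
  refine ⟨ghat.bddAbove_bisectionalValues, ?_, ?_⟩
  · intro M _ _ _ g φ hφ q X hX Y hY hX0 hY0
    obtain ⟨a, c, ha, hc, e⟩ := g.bisectional_eq q hX hY hX0 hY0
    have up := hφ.riemannE_le q
      (ghat.riemannE_le_of_bddAbove _ (ghat.bddAbove_bisectionalValues (φ q)))
    have lo := KahlerMetric.le_riemannE up a c
    rw [hfin] at lo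
    have hpos := g.bisectionalDenom_pos q ha hc
    rw [e, le_div_iff₀ hpos, div_le_iff₀ hpos]
    exact ⟨lo, up a c⟩
  · intro hcpt R₀
    -- `-K₁` is the minimum of `0` and the lower bound that `R₀` and the uniform upper bound `C` give.
    obtain ⟨C, hC, hbound⟩ := ghat.exists_riemannE_le
    refine ⟨max (-(1 / 4 * R₀ - ((n : ℝ) ^ 2 + n - 2) / 2 * C)) 0, ?_⟩
    set D := max (-(1 / 4 * R₀ - ((n : ℝ) ^ 2 + n - 2) / 2 * C)) 0 with hD
    have hD0 : 0 ≤ D := le_max_right _ _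
    have hD1 : -D ≤ 1 / 4 * R₀ - ((n : ℝ) ^ 2 + n - 2) / 2 * C :=
      neg_le.1 (le_max_left _ _)
    intro M _ _ _ g φ hφ hR q v
    have up := hφ.riemannE_le q (K := C) fun a c => (hbound _ a c).trans
      (mul_le_mul_of_nonneg_left (ghat.mul_le_bisectionalDenom _ a c) hC)
    have lo : ∀ a c, -D * g.bisectionalDenom q a c ≤
        g.riemannE q a (Complex.I • a) c (Complex.I • c) := by
      intro a c
      have h1 := KahlerMetric.le_riemannE up a c
      rw [hfin] at h1
      refine le_trans (mul_le_mul_of_nonneg_right ?_ ?_) h1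
      · linarith [hR q]
      · exact (mul_nonneg (g.innerCLM_self_nonneg q a) (g.innerCLM_self_nonneg q c)).trans
          (g.mul_le_bisectionalDenom q a c)
    have key := KahlerMetric.le_ricci hD0 lo v
    rw [hfin] at key
    refine le_trans ?_ key
    change -2 * (n : ℝ) * (n + 1) * D * g.innerCLM q v v ≤ _
    have := mul_nonneg (mul_nonneg (sq_nonneg (n : ℝ)) hD0) (g.innerCLM_self_nonneg q v)
    linarith
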